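/- Let $\gamma,\delta\in\mathbb{R}$ be not both zero, let $\lambda_1=\lambda_{1R}+\mathrm{i}\lambda_{1I}\in\mathbb{C}$ with $\lambda_{1I}\neq 0$, let $N\ge 1$ and $a_0,\dots,a_{N-1}\in\mathbb{C}$. Put $$\theta(\lambda;x,t)=\mathrm{i}\lambda\bigl(x+(2\gamma\lambda+4\delta\lambda^2)t\bigr)+\sum_{j=0}^{N-1}a_j(\lambda-\lambda_1)^j-\frac{\mathrm{i}\pi}{4},\qquad \theta_1=\theta(\lambda_1;x,t),$$ $$\Phi^{[k]}=\begin{bmatrix}\frac{1}{k!}\frac{\mathrm{d}^k}{\mathrm{d}\lambda^k}\mathrm{e}^{2\theta}\big|_{\lambda=\lambda_1}\\ \delta_{k,0}\end{bmatrix}\ (0\le k<N),\qquad \mathbf{Y}=[\Phi^{[0]},\dots,\Phi^{[N-1]}],\qquad \mathbf{M}=\mathbf{X}^\dagger\mathbf{S}\mathbf{X},$$ where $\mathbf{X}$ is the $2N\times N$ block matrix with $2\times1$ blocks $\mathbf{X}_{k,l}=\Phi^{[l-k]}$ for $k\le l$ and $0$ for $k>l$, and $\mathbf{S}$ is the $2N\times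 2N$ block matrix with $2\times 2$ blocks $\mathbf{S}_{k,l}=(-1)^k\binom{k+l}{k}(\lambda_1^*-\lambda_1)^{-(k+l+1)}\,\mathbb{I}_2$, $0\le k,l<N$. Let $$q^{[N]}(x,t)=2\,\mathbf{Y}_2\mathbf{M}^{-1}\mathbf{Y}_1^\dagger$$ ($\mathbf{Y}_1,\mathbf{Y}_2$ the first and second row of $\mathbf{Y}$) be the $N$-th order soliton, with the single spectral parameter $\lambda_1$, of the Hirota equation $\mathrm{i}q_t+\gamma(q_{xx}+2|q|^2q)+\mathrm{i}\delta(q_{xxx}+6|q|^2q_x)=0$. Put $$v_1=-4(\lambda_{1R}\gamma-\lambda_{1I}^2\delta+3\lambda_{1R}^2\delta),\qquad \mu_\kappa=\frac{N+1-2\kappa}{2\lambda_{1I}}\quad(\kappa=1,\dots,N).$$ Then the following hold as $t\to+\infty$, and also as $t\to-\infty$. (a) For every $\kappa\in\{1,\dots,N\}$ and every $s\in\mathbb{R}$, along the curve $x=s+v_1t+\mu_\kappa\log|t|$ the function $\mathrm{e}^{2\mathrm{i}\,\mathrm{Im}(\theta_1)}q^{[N]}(x,t)$ has a non-zero limit in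 $\mathbb{C}$; in particular $|q^{[N]}(x,t)|$ has a non-zero limit. (b) Along every other curve $x=s+vt+\beta\log|t|$ with $s,v,\beta\in\mathbb{R}$, that is, with $v\neq v_1$ or $\beta\notin\{\mu_1,\dots,\mu_N\}$, $q^{[N]}(x,t)\to 0$. (c) More generally, $q^{[N]}(X(t),t)\to0$ along every curve $x=X(t)$ (an arbitrary function $X:\mathbb{R}\to\mathbb{R}$) with $|X(t)-v_1t-\mu_\kappa\log|t||\to\infty$ for every $\kappa\in\{1,\dots,N\}$. -/

import Mathlib

open Filter Topology

noncomputable section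

namespace Hirota

/-- The phase `θ(λ; x, t) = iλ(x + (2γλ + 4δλ²)t) + ∑_{j<N} a_j (λ - λ₁)^j - iπ/4` of the solution
of the Lax pair of the Hirota equation
`i q_t + γ (q_xx + 2|q|² q) + i δ (q_xxx + 6|q|² q_x) = 0` over the zero seed. -/
def phase {N : ℕ} (γ δ : ℝ) (lam1 : ℂ) (a : Fin N → ℂ) (x t : ℝ) (lam : ℂ) : ℂ :=
  Complex.I * lam * ((x : ℂ) + (2 * (γ : ℂ) * lam + 4 * (δ : ℂ) * lam ^ 2) * (t : ℂ))
    + ∑ j : Fin N, a j * (lam - lam1) ^ (j : ℕ) - Complex.I / 4 * (Real.pi : ℂ)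

/-- The `k`-th Taylor coefficient at `λ = λ₁` of the vector solution `(e^{2θ(λ)}, 1)ᵀ`. -/
def phiCoeff {N : ℕ} (γ δ : ℝ) (lam1 : ℂ) (a : Fin N → ℂ) (x t : ℝ) (k : ℕ) : Fin 2 → ℂ :=
  ![(k.factorial : ℂ)⁻¹ *
      iteratedDeriv k (fun lam : ℂ => Complex.exp (2 * phase γ δ lam1 a x t lam)) lam1,
    if k = 0 then 1 else 0]

/-- The `2 × N` matrix `Y = [Φ^[0], Φ^[1], …, Φ^[N-1]]`. -/
def matY {N : ℕ} (γ δ : ℝ) (lam1 : ℂ) (a : Fin N → ℂ) (x t : ℝ) : Matrix (Fin 2) (Fin N) ℂ :=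
  Matrix.of fun i l => phiCoeff γ δ lam1 a x t (l : ℕ) i

/-- The block upper triangular Toeplitz matrix with blocks `X_{k,l} = Φ^[l-k]` for `k ≤ l`
(each block is a column vector of length 2). -/
def matX {N : ℕ} (γ δ : ℝ) (lam1 : ℂ) (a : Fin N → ℂ) (x t : ℝ) :
    Matrix (Fin N × Fin 2) (Fin N) ℂ :=
  Matrix.of fun p l =>
    if p.1 ≤ l then phiCoeff γ δ lam1 a x t ((l : ℕ) - (p.1 : ℕ)) p.2 else 0

/-- The block matrix with blocks `S_{k,l} = (-1)^k binom(k+l, k) / (λ₁* - λ₁)^(k+l+1) · I₂`,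
where `0 ≤ k, l < N`. -/
def matS (N : ℕ) (lam1 : ℂ) : Matrix (Fin N × Fin 2) (Fin N × Fin 2) ℂ :=
  Matrix.of fun p r =>
    if p.2 = r.2 then
      (-1) ^ (p.1 : ℕ) * (((p.1 : ℕ) + (r.1 : ℕ)).choose (p.1 : ℕ) : ℂ) /
        ((starRingEnd ℂ) lam1 - lam1) ^ ((p.1 : ℕ) + (r.1 : ℕ) + 1)
    else 0

/-- `M = X† S X`. -/
def matM {N : ℕ} (γ δ : ℝ) (lam1 : ℂ) (a : Fin N → ℂ) (x t : ℝ) : Matrix (Fin N) (Fin N) ℂ :=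
  (matX γ δ lam1 a x t).conjTranspose * matS N lam1 * matX γ δ lam1 a x t

/-- The `N`-th order soliton with the single spectral parameter `λ₁`: the Bäcklund transform
`q^[N] = 2 Y₂ M⁻¹ Y₁†` of the zero seed, with `Y₁`, `Y₂` the first and second row of `Y`. -/
def soliton {N : ℕ} (γ δ : ℝ) (lam1 : ℂ) (a : Fin N → ℂ) (x t : ℝ) : ℂ :=
  2 * (matY γ δ lam1 a x t * (matM γ δ lam1 a x t)⁻¹ *
    (matY γ δ lam1 a x t).conjTranspose) 1 0

/-- The velocity `v₁ = -4(λ_{1R} γ - λ_{1I}² δ + 3 λ_{1R}² δ)`. -/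
def velocity (γ δ : ℝ) (lam1 : ℂ) : ℝ :=
  -4 * (lam1.re * γ - lam1.im ^ 2 * δ + 3 * lam1.re ^ 2 * δ)

/-- The coefficient `(N + 1 - 2κ) / (2 λ_{1I})` of the logarithm. -/
def logCoeff (N : ℕ) (lam1 : ℂ) (κ : ℕ) : ℝ :=
  ((N : ℝ) + 1 - 2 * (κ : ℝ)) / (2 * lam1.im)

/-- The characteristic curve `x = s + v₁ t + (N + 1 - 2κ) / (2 λ_{1I}) log |t|`. -/
def charCurve (N : ℕ) (γ δ : ℝ) (lam1 : ℂ) (κ : ℕ) (s t : ℝ) : ℝ :=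
  s + velocity γ δ lam1 * t + logCoeff N lam1 κ * Real.log |t|

end Hirota

end

/-!
The `N`-th order soliton is studied through polynomials in the spectral parameter. Write `z = λ₁`,
`w = λ - z`, let `f(w)` be the Taylor series of `exp (2 θ)` at `z`, and let `P ↦ P⋆` conjugate the
coefficients of a polynomial in `λ`. The matrix `M` is the coefficient array of
`(1 + f̄(u) f(w)) / (z̄ - z + u - w)`, hence it solves a Sylvester equation; this equation shows that
`M` is invertible and that the column `M⁻¹ e₀` yields a pair of polynomials in `λ`, the second row
of the Darboux matrix up to a scalar factor: `a` monic of degree `N`, `b` of degree `< N`, with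
`a + b f ≡ 0` and `b⋆ ≡ a⋆ f` modulo `w ^ N`, and `q = 2 b_{N-1}`
(`IsSylvester.exists_darbouxPair`, `exists_darbouxPair_soliton`). The two congruences force
`a a⋆ + b b⋆ = ((λ - z) (λ - z̄)) ^ N` (`IsDarbouxPair.mul_conj_add`). So `a` and `b` are bounded at
each real point, and they converge along every ultrafilter (`exists_limit_pair`). It remains to
identify the limits.

Near the ray `x = v₁ t` one has `f ≈ ρ exp (τ w)` modulo `w ^ N`, with `ρ = exp (2 θ₁)` and with `τ`
a non-zero multiple of `t` (`expLike_phaseSeries`). A congruence `Q ≡ P f` between bounded sequences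
then annihilates low coefficients of the limit of `P`, and when `ρ τ ^ (N - 1 - 2 m)` has a non-zero
limit it relates one further coefficient of `P` to a coefficient of `Q`; the reason is that the
matrices `[1/(n+i-j)!]` are invertible (`tendsto_of_toeplitz`). This is applied to the two
congruences and to their inverted forms `b ≡ -a / f`, `a⋆ ≡ b⋆ / f`.

* Between the characteristic curves `ρ τ ^ (N - 1 - 2 m) → 0` and `ρ τ ^ (N + 1 - 2 m) → ∞` for
  some `m`. Then the limit of `b` is divisible by `(λ - z) ^ m (λ - z̄) ^ (N - m)`, so it vanishes
  (`tendsto_zero_of_gap`). Far from the ray `f` or `1 / f` decays exponentially, and `b → 0` again.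
* On the curve `κ = m + 1` the modulus of `ρ τ ^ (N - 1 - 2 m)` is constant, and after removal of
  the phase of `ρ` the limits are `b = β (λ - z) ^ m (λ - z̄) ^ (N - 1 - m)` and
  `a = (λ - z) ^ (N - 1 - m) (λ - z̄) ^ m (λ - c)`, where `z - c = R β` and `z - c̄ = R' β̄` with known
  `R`, `R'`. Eliminating `c` gives `(R - R̄') β = z - z̄ ≠ 0`, which determines `β` and shows `β ≠ 0`
  (`tendsto_of_balance`).
-/

namespace Hirota

open Finset.HasAntidiagonal (antidiagonal)
open Polynomial

/-! ### Triangular Toeplitz systems with exponential symbol -/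

/-- If `deg P < s` and `s` consecutive coefficients of `P exp` vanish, then `P = 0`: the `n`-th
derivative of `P exp` is again of the form `Q exp` with `deg Q < s`. -/
theorem coeff_mul_exp_eq_zero {s : ℕ} (n : ℕ) (P : ℂ[X]) (hP : P.degree < s)
    (h : ∀ i < s, PowerSeries.coeff (n + i) ((P : PowerSeries ℂ) * PowerSeries.exp ℂ) = 0) :
    P = 0 := by
  induction n generalizing P with
  | zero =>
    have h1 : (PowerSeries.X : PowerSeries ℂ) ^ s ∣ (P : PowerSeries ℂ) * PowerSeries.exp ℂ := by
      rw [PowerSeries.X_pow_dvd_iff]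
      intro m hm
      simpa using h m hm
    have h2 : (P : PowerSeries ℂ) = (P : PowerSeries ℂ) * PowerSeries.exp ℂ *
        PowerSeries.evalNegHom (PowerSeries.exp ℂ) := by
      rw [mul_assoc, PowerSeries.exp_mul_exp_neg_eq_one, mul_one]
    have h3 : (PowerSeries.X : PowerSeries ℂ) ^ s ∣ (P : PowerSeries ℂ) := by
      rw [h2]; exact h1.mul_right _
    rw [PowerSeries.X_pow_dvd_iff] at h3
    ext m
    by_cases hm : m < s
    · simpa using h3 m hm
    · rw [coeff_zero]
      exact coeff_eq_zero_of_degree_lt (hP.trans_le (by exact_mod_cast not_lt.mp hm))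
  | succ n ih =>
    have hd : (P + derivative P).degree < s := by
      refine (degree_add_le _ _).trans_lt (max_lt hP ?_)
      exact (degree_derivative_le).trans_lt hP
    have h0 : P + derivative P = 0 := by
      refine ih _ hd fun i hi => ?_
      have h1 : ((P + derivative P : ℂ[X]) : PowerSeries ℂ) * PowerSeries.exp ℂ =
          PowerSeries.derivative ℂ ((P : PowerSeries ℂ) * PowerSeries.exp ℂ) := by
        rw [Derivation.leibniz, PowerSeries.derivative_coe, PowerSeries.derivative_exp]
        simp only [smul_eq_mul, coe_add]
        ring
      rw [h1, PowerSeries.coeff_derivative]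
      have := h i hi
      rw [show n + 1 + i = n + i + 1 by ring] at this
      rw [this, zero_mul]
    by_contra hne
    have hlt := degree_derivative_lt hne
    have : P = - derivative P := eq_neg_of_add_eq_zero_left h0
    rw [← degree_neg (derivative P), ← this] at hlt
    exact lt_irrefl _ hlt

/-- The matrix `[1/(n+i-j)!]` with `0 ≤ i, j < s`, where `1/k! = 0` for negative `k`. -/
noncomputable def expMatrix (n s : ℕ) : Matrix (Fin s) (Fin s) ℂ :=
  Matrix.of fun i j => if (j : ℕ) ≤ n + i then ((n + i - j).factorial : ℂ)⁻¹ else 0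

/-- A sum over `Fin N` in which only the indices `i ≤ k` contribute, as a convolution. -/
theorem sum_fin_eq_antidiagonal {R : Type*} [AddCommMonoid R] {N : ℕ} (k : ℕ) (g : ℕ → ℕ → R)
    (hg : ∀ i j, N ≤ i → i + j = k → g i j = 0) :
    ∑ i : Fin N, (if (i : ℕ) ≤ k then g i (k - i) else 0) =
      ∑ p ∈ antidiagonal k, g p.1 p.2 := by
  rw [Finset.Nat.sum_antidiagonal_eq_sum_range_succ g,
    Fin.sum_univ_eq_sum_range (fun i => if i ≤ k then g i (k - i) else 0)]
  rw [← Finset.sum_filter]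
  refine Finset.sum_subset (fun i hi => ?_) (fun i hi hi' => ?_)
  · simp only [Finset.mem_filter, Finset.mem_range] at hi ⊢; omega
  · simp only [Finset.mem_filter, Finset.mem_range] at hi hi'
    exact hg _ _ (by omega) (by omega)

theorem isUnit_det_expMatrix (n s : ℕ) : IsUnit (expMatrix n s).det := by
  rw [isUnit_iff_ne_zero]
  intro h0
  obtain ⟨x, hx, hx0⟩ := Matrix.exists_mulVec_eq_zero_iff.mpr h0
  apply hx
  let P : ℂ[X] := ∑ j : Fin s, C (x j) * X ^ (j : ℕ)
  have hc : ∀ j : Fin s, P.coeff j = x j := by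
    intro j
    simp only [P, finsetSum_coeff, coeff_C_mul, coeff_X_pow, Fin.val_inj]
    simp
  have hP : P.degree < s := by
    refine (degree_sum_le _ _).trans_lt ?_
    rw [Finset.sup_lt_iff (by exact WithBot.bot_lt_coe s)]
    intro j _
    exact (degree_C_mul_X_pow_le _ _).trans_lt (by exact_mod_cast j.2)
  have : P = 0 := by
    refine coeff_mul_exp_eq_zero n P hP fun i hi => ?_
    have := congrFun hx0 ⟨i, hi⟩
    simp only [Matrix.mulVec, dotProduct, expMatrix, Matrix.of_apply, Pi.zero_apply] at this
    rw [PowerSeries.coeff_mul, ← this, ← sum_fin_eq_antidiagonal (N := s) _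
      (fun i j => PowerSeries.coeff i (P : PowerSeries ℂ) *
        PowerSeries.coeff j (PowerSeries.exp ℂ))]
    · refine Finset.sum_congr rfl fun j _ => ?_
      split_ifs
      · simp [hc, PowerSeries.coeff_exp, mul_comm]
      · simp
    · intro i j hi _
      rw [Polynomial.coeff_coe,
        coeff_eq_zero_of_degree_lt (hP.trans_le (by exact_mod_cast hi)), zero_mul]
  ext j
  rw [← hc j, this]
  simp

theorem tendsto_mulVec {ι : Type*} {u : Filter ι} {s : ℕ} {A : ι → Matrix (Fin s) (Fin s) ℂ}
    {B : Matrix (Fin s) (Fin s) ℂ} {v : ι → Fin s → ℂ} {w : Fin s → ℂ}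
    (hA : Tendsto A u (𝓝 B)) (hv : Tendsto v u (𝓝 w)) :
    Tendsto (fun t => (A t).mulVec (v t)) u (𝓝 (B.mulVec w)) := by
  refine tendsto_pi_nhds.mpr fun i => ?_
  simp only [Matrix.mulVec, dotProduct]
  refine tendsto_finsetSum _ fun j _ => ?_
  exact (tendsto_pi_nhds.mp (tendsto_pi_nhds.mp hA i) j).mul (tendsto_pi_nhds.mp hv j)

set_option maxHeartbeats 400000 in
/-- Asymptotics of the solutions of a triangular Toeplitz system `Q ≡ P f` modulo `w ^ N`, where
`f = ∑ ρ τ ^ k e_k w ^ k` with `e_k → 1/k!` and `τ → ∞`. The last `s` equations, divided by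
appropriate powers of `τ`, are a perturbation of a system with matrix `[1/(N-s+i-j)!]` for the
rescaled unknowns `P_j τ ^ (s-1-j)`, `j < s`. -/
theorem tendsto_of_toeplitz {ι : Type*} {u : Filter ι} {N s : ℕ} (hs : 1 ≤ s) (hsN : s ≤ N)
    {P Q e : ι → ℕ → ℂ} {ρ τ : ι → ℂ} {η q : ℂ}
    (hρ : ∀ᶠ t in u, ρ t ≠ 0) (hτ : Tendsto (fun t => ‖τ t‖) u atTop)
    (he : ∀ k < N, Tendsto (fun t => e t k) u (𝓝 ((k.factorial : ℂ)⁻¹)))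
    (hPQ : ∀ᶠ t in u, ∀ k < N, Q t k =
      ∑ p ∈ antidiagonal k, P t p.1 * (ρ t * τ t ^ p.2 * e t p.2))
    (hP : ∀ k < N, IsBoundedUnder (· ≤ ·) u fun t => ‖P t k‖)
    (hQ : ∀ k < N, IsBoundedUnder (· ≤ ·) u fun t => ‖Q t k‖)
    (hη : Tendsto (fun t => (ρ t)⁻¹ * τ t ^ (2 * (s : ℤ) - 1 - N)) u (𝓝 η))
    (hq : Tendsto (fun t => η * Q t (N - s)) u (𝓝 (η * q))) :
    (∀ j < s - 1, Tendsto (fun t => P t j) u (𝓝 0)) ∧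
      Tendsto (fun t => P t (s - 1)) u
        (𝓝 ((expMatrix (N - s) s)⁻¹ ⟨s - 1, by omega⟩ ⟨0, by omega⟩ * (η * q))) := by
  classical
  set n := N - s with hn
  let x : ι → Fin s → ℂ := fun t j => P t j * τ t ^ ((s : ℤ) - 1 - (j : ℕ))
  let A : ι → Matrix (Fin s) (Fin s) ℂ := fun t =>
    Matrix.of fun i j => if (j : ℕ) ≤ n + i then e t (n + i - j) else 0
  have hτ0 : ∀ᶠ t in u, τ t ≠ 0 := by
    filter_upwards [hτ.eventually_gt_atTop 0] with t ht
    exact norm_pos_iff.mp ht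
  have hpow : ∀ m : ℤ, m < 0 → Tendsto (fun t => τ t ^ m) u (𝓝 0) := by
    intro m hm
    rw [tendsto_zero_iff_norm_tendsto_zero]
    simp only [norm_zpow]
    exact (tendsto_zpow_atTop_zero hm).comp hτ
  have hA : Tendsto A u (𝓝 (expMatrix n s)) := by
    refine tendsto_pi_nhds.mpr fun i => tendsto_pi_nhds.mpr fun j => ?_
    simp only [A, expMatrix, Matrix.of_apply]
    split_ifs
    · exact he _ (by omega)
    · exact tendsto_const_nhds
  have hdet : (expMatrix n s).det ≠ 0 := (isUnit_det_expMatrix n s).ne_zero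
  have hAdet : Tendsto (fun t => (A t).det) u (𝓝 (expMatrix n s).det) :=
    ((continuous_id.matrix_det).tendsto _).comp hA
  have hAinv : Tendsto (fun t => (A t)⁻¹) u (𝓝 (expMatrix n s)⁻¹) := by
    simp only [Matrix.inv_def, Ring.inverse_eq_inv']
    exact (hAdet.inv₀ hdet).smul (((continuous_id.matrix_adjugate).tendsto _).comp hA)
  -- The tail `∑_{s ≤ j ≤ k} P_j τ ^ (s-1-j) e_{k-j}` involves only negative powers of `τ`.
  have htail : ∀ k < N, Tendsto (fun t => ∑ j ∈ (Finset.range (k + 1)).filter (fun j => ¬ j < s),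
      P t j * τ t ^ ((s : ℤ) - 1 - (j : ℕ)) * e t (k - j)) u (𝓝 0) := by
    intro k hk
    rw [show (0 : ℂ) = ∑ j ∈ (Finset.range (k + 1)).filter (fun j => ¬ j < s), 0 by simp]
    refine tendsto_finsetSum _ fun j hj => ?_
    simp only [Finset.mem_filter, Finset.mem_range] at hj
    have h1 : Tendsto (fun t => P t j * τ t ^ ((s : ℤ) - 1 - (j : ℕ))) u (𝓝 0) :=
      isBoundedUnder_le_mul_tendsto_zero (hP j (by omega)) (hpow _ (by omega))
    simpa using h1.mul (he (k - j) (by omega))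
  have hmain : ∀ i : Fin s, Tendsto (fun t => (A t).mulVec (x t) i) u
      (𝓝 (if (i : ℕ) = 0 then η * q else 0)) := by
    intro i
    have hk : n + (i : ℕ) < N := by omega
    have h1 : Tendsto (fun t => (ρ t)⁻¹ * τ t ^ (2 * (s : ℤ) - 1 - N) * τ t ^ (-((i : ℕ) : ℤ)) *
        Q t (n + i)) u (𝓝 (if (i : ℕ) = 0 then η * q else 0)) := by
      split_ifs with hi
      · simp only [hi, Nat.cast_zero, neg_zero, zpow_zero, mul_one, add_zero]
        have h2 : Tendsto (fun t => ((ρ t)⁻¹ * τ t ^ (2 * (s : ℤ) - 1 - N) - η) * Q t n) u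
            (𝓝 0) := by
          refine Filter.Tendsto.zero_mul_isBoundedUnder_le ?_ (hQ n (by omega))
          simpa using hη.sub_const η
        simpa [sub_mul] using h2.add hq
      · have h2 := hη.mul (hpow (-((i : ℕ) : ℤ)) (by omega))
        rw [mul_zero] at h2
        exact Filter.Tendsto.zero_mul_isBoundedUnder_le h2 (hQ _ hk)
    have h3 := h1.sub (htail _ hk)
    rw [sub_zero] at h3
    refine h3.congr' ?_
    filter_upwards [hτ0, hρ, hPQ] with t ht hρt hPQt
    have h4 : (ρ t)⁻¹ * τ t ^ (2 * (s : ℤ) - 1 - N) * τ t ^ (-((i : ℕ) : ℤ)) * Q t (n + i) =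
        ∑ j ∈ Finset.range (n + i + 1),
          P t j * τ t ^ ((s : ℤ) - 1 - (j : ℕ)) * e t (n + i - j) := by
      rw [hPQt _ hk, Finset.Nat.sum_antidiagonal_eq_sum_range_succ_mk, Finset.mul_sum]
      refine Finset.sum_congr rfl fun j hj => ?_
      simp only [Finset.mem_range] at hj
      have h5 : τ t ^ ((s : ℤ) - 1 - (j : ℕ)) = τ t ^ (2 * (s : ℤ) - 1 - N) *
          τ t ^ (-((i : ℕ) : ℤ)) * τ t ^ (n + i - j) := by
        rw [← zpow_natCast (τ t), ← zpow_add₀ ht, ← zpow_add₀ ht]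
        congr 1
        rw [Nat.cast_sub (by omega)]
        push_cast [hn, Nat.cast_sub hsN]
        ring
      rw [h5]
      field_simp
    rw [h4, ← Finset.sum_filter_add_sum_filter_not _ (fun j => j < s), add_sub_cancel_right]
    simp only [Matrix.mulVec, dotProduct, A, x, Matrix.of_apply]
    rw [Fin.sum_univ_eq_sum_range (fun j => (if j ≤ n + (i : ℕ) then e t (n + i - j) else 0) *
      (P t j * τ t ^ ((s : ℤ) - 1 - (j : ℕ)))) s]
    simp only [ite_mul, zero_mul]
    rw [← Finset.sum_filter]
    refine Finset.sum_congr ?_ fun j _ => mul_comm _ _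
    ext j
    simp only [Finset.mem_filter, Finset.mem_range]
    omega
  have hx : Tendsto x u (𝓝 ((expMatrix n s)⁻¹.mulVec
      (fun i : Fin s => if (i : ℕ) = 0 then η * q else 0))) := by
    have h1 : Tendsto (fun t => (A t)⁻¹.mulVec ((A t).mulVec (x t))) u (𝓝 ((expMatrix n s)⁻¹.mulVec
      (fun i : Fin s => if (i : ℕ) = 0 then η * q else 0))) := by
      exact tendsto_mulVec hAinv (tendsto_pi_nhds.mpr hmain)
    refine h1.congr' ?_
    filter_upwards [hAdet.eventually_ne hdet] with t ht
    rw [Matrix.mulVec_mulVec, Matrix.nonsing_inv_mul _ (isUnit_iff_ne_zero.mpr ht),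
      Matrix.one_mulVec]
  have hx' := tendsto_pi_nhds.mp hx
  constructor
  · intro j hj
    have h1 := (hx' ⟨j, by omega⟩).mul (hpow ((j : ℤ) - (s - 1)) (by omega))
    rw [mul_zero] at h1
    refine h1.congr' ?_
    filter_upwards [hτ0] with t ht
    simp only [x]
    rw [mul_assoc, ← zpow_add₀ ht]
    simp
  · have h1 := hx' ⟨s - 1, by omega⟩
    have h2 : ∀ t, x t ⟨s - 1, by omega⟩ = P t (s - 1) := by
      intro t
      simp [x, Nat.cast_sub hs]
    simp only [h2] at h1
    convert h1 using 2
    simp only [Matrix.mulVec, dotProduct]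
    rw [Finset.sum_eq_single (⟨0, by omega⟩ : Fin s)]
    · simp
    · intro b _ hb
      rw [if_neg, mul_zero]
      intro h
      exact hb (Fin.ext h)
    · simp

/-! ### From the Sylvester equation to Darboux pairs -/

/-- The sequence `0, g 0, g 1, …`. -/
def prev {R : Type*} [Zero R] (g : ℕ → R) : ℕ → R
  | 0 => 0
  | n + 1 => g n

@[simp] theorem prev_zero {R : Type*} [Zero R] (g : ℕ → R) : prev g 0 = 0 := rfl
@[simp] theorem prev_succ {R : Type*} [Zero R] (g : ℕ → R) (n : ℕ) : prev g (n + 1) = g n := rfl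

theorem sum_prev_mul {N : ℕ} (g w : ℕ → ℂ) (hw : w N = 0) :
    ∑ l ∈ Finset.range N, prev g l * w l = ∑ l ∈ Finset.range N, g l * w (l + 1) := by
  cases N with
  | zero => simp
  | succ n =>
    rw [Finset.sum_range_succ', Finset.sum_range_succ]
    simp [hw]

/-- `m` is the coefficient array of `(1 + f̄(u) f(w)) / (d + u - w)`, stated as the Sylvester
equation that results from multiplication by `d + u - w`. -/
def IsSylvester (d : ℂ) (f : PowerSeries ℂ) (m : ℕ → ℕ → ℂ) : Prop :=
  ∀ k l, d * m k l + prev (fun i => m i l) k - prev (m k) l =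
    (if k = 0 then 1 else 0) * (if l = 0 then 1 else 0) +
      (starRingEnd ℂ) (PowerSeries.coeff k f) * PowerSeries.coeff l f

namespace IsSylvester

variable {d : ℂ} {f : PowerSeries ℂ} {m : ℕ → ℕ → ℂ}

theorem conj_eq (h : IsSylvester d f m) (hd : (starRingEnd ℂ) d = -d) (hd0 : d ≠ 0) (k l : ℕ) :
    (starRingEnd ℂ) (m k l) = - m l k := by
  induction hn : k + l using Nat.strong_induction_on generalizing k l with
  | _ n ih =>
    have h1 := congrArg (starRingEnd ℂ) (h k l)
    have h2 := h l k
    have h3 : (starRingEnd ℂ) (prev (fun i => m i l) k) = - prev (m l) k := by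
      cases k with
      | zero => simp
      | succ k => exact ih (k + l) (by omega) k l rfl
    have h4 : (starRingEnd ℂ) (prev (m k) l) = - prev (fun i => m i k) l := by
      cases l with
      | zero => simp
      | succ l => exact ih (k + l) (by omega) k l rfl
    simp only [map_sub, map_add, map_mul, hd, h3, h4, Complex.conj_conj] at h1
    have h5 : ∀ j : ℕ, (starRingEnd ℂ) (if j = 0 then 1 else 0) = if j = 0 then 1 else 0 := by
      intro j; split_ifs <;> simp
    rw [h5, h5] at h1
    have h6 : d * ((starRingEnd ℂ) (m k l) + m l k) = 0 := by linear_combination h2 - h1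
    exact eq_neg_of_add_eq_zero_left ((mul_eq_zero.mp h6).resolve_left hd0)

/-- Let `w` be in the kernel of the truncated matrix `m`. The Sylvester equation, paired with `w` on
both sides, gives `|w₀|² + |∑ f_l w_l|² = 0`; hence `w₀ = 0`, and the shift of `w` is again in the
kernel. -/
theorem kernel_step (h : IsSylvester d f m) (hd : (starRingEnd ℂ) d = -d) (hd0 : d ≠ 0) {N : ℕ}
    {w : ℕ → ℂ} (hw : w N = 0) (hk : ∀ k < N, ∑ l ∈ Finset.range N, m k l * w l = 0) (hN : 0 < N) :
    w 0 = 0 ∧ ∀ k < N, ∑ l ∈ Finset.range N, m k l * w (l + 1) = 0 := by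
  set y : ℂ := ∑ l ∈ Finset.range N, PowerSeries.coeff l f * w l with hy
  have hrow : ∀ k < N, - ∑ l ∈ Finset.range N, m k l * w (l + 1) =
      (if k = 0 then 1 else 0) * w 0 + (starRingEnd ℂ) (PowerSeries.coeff k f) * y := by
    intro k hkN
    have h1 : ∑ l ∈ Finset.range N, (d * m k l + prev (fun i => m i l) k - prev (m k) l) * w l =
        ∑ l ∈ Finset.range N, ((if k = 0 then 1 else 0) * (if l = 0 then 1 else 0) +
      (starRingEnd ℂ) (PowerSeries.coeff k f) * PowerSeries.coeff l f) * w l :=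
      Finset.sum_congr rfl fun l _ => by rw [h k l]
    simp only [add_mul, sub_mul, Finset.sum_add_distrib, Finset.sum_sub_distrib, mul_assoc,
      ← Finset.mul_sum] at h1
    rw [hk k hkN, sum_prev_mul _ _ hw] at h1
    have h2 : ∑ l ∈ Finset.range N, prev (fun i => m i l) k * w l = 0 := by
      cases k with
      | zero => simp
      | succ k => exact hk k (by omega)
    have h3 : ∑ l ∈ Finset.range N, (if l = 0 then (1 : ℂ) else 0) * w l = w 0 := by
      simp [hN]
    rw [h2, h3] at h1
    rw [hy, ← h1]; ring
  have hz : ∑ k ∈ Finset.range N, (starRingEnd ℂ) (w k) *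
      (- ∑ l ∈ Finset.range N, m k l * w (l + 1)) = 0 := by
    simp only [mul_neg, Finset.mul_sum, Finset.sum_neg_distrib, neg_eq_zero]
    rw [Finset.sum_comm]
    refine Finset.sum_eq_zero fun l hl => ?_
    have h1 := congrArg (starRingEnd ℂ) (hk l (Finset.mem_range.mp hl))
    simp only [map_sum, map_mul, h.conj_eq hd hd0, map_zero, neg_mul, Finset.sum_neg_distrib,
      neg_eq_zero] at h1
    calc _ = w (l + 1) * ∑ k ∈ Finset.range N, m k l * (starRingEnd ℂ) (w k) := by
          rw [Finset.mul_sum]; exact Finset.sum_congr rfl fun _ _ => by ring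
      _ = 0 := by rw [h1, mul_zero]
  have hsq : (starRingEnd ℂ) (w 0) * w 0 + (starRingEnd ℂ) y * y = 0 := by
    rw [← hz, Finset.sum_congr rfl fun k hk' => by rw [hrow k (Finset.mem_range.mp hk')]]
    simp only [mul_add, Finset.sum_add_distrib]
    congr 1
    · rw [Finset.sum_eq_single 0] <;> simp +contextual [hN]
    · rw [hy, map_sum, Finset.sum_mul]
      exact Finset.sum_congr rfl fun _ _ => by rw [map_mul]; ring
  have hsq' : ‖w 0‖ ^ 2 + ‖y‖ ^ 2 = 0 := by
    rw [Complex.conj_mul', Complex.conj_mul'] at hsq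
    exact_mod_cast hsq
  have hw0 : w 0 = 0 := by
    rw [← norm_eq_zero, ← sq_eq_zero_iff]; nlinarith [sq_nonneg ‖w 0‖, sq_nonneg ‖y‖]
  have hy0 : y = 0 := by
    rw [← norm_eq_zero, ← sq_eq_zero_iff]; nlinarith [sq_nonneg ‖w 0‖, sq_nonneg ‖y‖]
  refine ⟨hw0, fun k hkN => ?_⟩
  have := hrow k hkN
  rw [hw0, hy0] at this
  simpa using this

theorem eq_zero_of_kernel (h : IsSylvester d f m) (hd : (starRingEnd ℂ) d = -d) (hd0 : d ≠ 0)
    {N : ℕ} {w : ℕ → ℂ} (hw : ∀ l, N ≤ l → w l = 0)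
    (hk : ∀ k < N, ∑ l ∈ Finset.range N, m k l * w l = 0) (n : ℕ) : w n = 0 := by
  rcases Nat.eq_zero_or_pos N with rfl | hN
  · exact hw _ (Nat.zero_le _)
  have key : ∀ n, ∀ k < N, ∑ l ∈ Finset.range N, m k l * w (l + n) = 0 := by
    intro n
    induction n with
    | zero => simpa using hk
    | succ n ih =>
      have := (h.kernel_step hd hd0 (w := fun l => w (l + n)) (hw _ (by omega)) ih hN).2
      intro k hkN
      rw [← this k hkN]
      exact Finset.sum_congr rfl fun l _ => by rw [add_right_comm, add_assoc]
  simpa using (h.kernel_step hd hd0 (w := fun l => w (l + n)) (hw _ (by omega)) (key n) hN).1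

theorem isUnit_det (h : IsSylvester d f m) (hd : (starRingEnd ℂ) d = -d) (hd0 : d ≠ 0) (N : ℕ) :
    IsUnit (Matrix.of fun k l : Fin N => m k l).det := by
  rw [isUnit_iff_ne_zero]
  intro h0
  obtain ⟨x, hx, hx0⟩ := Matrix.exists_mulVec_eq_zero_iff.mpr h0
  apply hx
  let w : ℕ → ℂ := fun l => if hl : l < N then x ⟨l, hl⟩ else 0
  have hwx : ∀ l : Fin N, w l = x l := fun l => by simp [w]
  ext l
  rw [← hwx]
  refine h.eq_zero_of_kernel hd hd0 (N := N) (fun l hl => by simp [w, hl]) (fun k hk => ?_) l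
  have := congrFun hx0 ⟨k, hk⟩
  simp only [Matrix.mulVec, dotProduct, Matrix.of_apply, Pi.zero_apply, ← hwx] at this
  rwa [Fin.sum_univ_eq_sum_range (fun l => m k l * w l)] at this

end IsSylvester

/-- A Darboux pair for the Taylor series `f` at `z`: polynomials `a`, monic of degree `N`, and `b`,
of degree less than `N`, such that `a + b f ≡ 0` and `b⋆ ≡ a⋆ f` modulo `(λ - z) ^ N`, where `⋆`
conjugates the coefficients. They form the second row of the Darboux matrix, multiplied by
`(λ - z̄) ^ N`. The congruences are stated for the expansions in powers of `w = λ - z`. -/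
structure IsDarbouxPair (N : ℕ) (z : ℂ) (f : PowerSeries ℂ) (a b : ℂ[X]) : Prop where
  monic : a.Monic
  natDegree_eq : a.natDegree = N
  degree_lt : b.degree < N
  coeff_add : ∀ k < N,
    PowerSeries.coeff k ((taylor z b : PowerSeries ℂ) * f + (taylor z a : PowerSeries ℂ)) = 0
  coeff_sub : ∀ k < N,
    PowerSeries.coeff k ((taylor z (a.map (starRingEnd ℂ)) : PowerSeries ℂ) * f -
      (taylor z (b.map (starRingEnd ℂ)) : PowerSeries ℂ)) = 0

/-- The telescoping sum behind the resolvent of a nilpotent shift. -/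
theorem sum_telescope {R : Type*} [CommRing R] (p : R) (g : ℕ → R) (l q : ℕ) (hl : l ≤ q) :
    ∑ n ∈ Finset.range (l + 1), p ^ (q - n) * (-p * g (l - n) + prev g (l - n)) =
      - p ^ (q + 1) * g l := by
  induction l generalizing q with
  | zero => simp [pow_succ]; ring
  | succ l ih =>
    obtain ⟨q, rfl⟩ : ∃ r, q = r + 1 := ⟨q - 1, by omega⟩
    rw [Finset.sum_range_succ']
    have := ih q (by omega)
    simp only [Nat.add_sub_add_right] at this ⊢
    rw [this]
    simp
    ring

theorem comp_X_sub_C_eq_taylor (P : ℂ[X]) (y : ℂ) : P.comp (X - C y) = taylor (-y) P := by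
  rw [taylor_apply, map_neg, sub_eq_add_neg]

theorem taylor_comp_sub (P : ℂ[X]) (z y : ℂ) :
    taylor z (P.comp (X - C y)) = P.comp (X - C (y - z)) := by
  rw [taylor_apply, comp_assoc]
  congr 1
  simp
  ring

/-- The polynomial `∑ l, c l * X ^ (N - 1 - l)`. -/
noncomputable def descPoly {N : ℕ} (c : Fin N → ℂ) : ℂ[X] :=
  ∑ l : Fin N, C (c l) * X ^ (N - 1 - (l : ℕ))

theorem degree_descPoly_lt {N : ℕ} (c : Fin N → ℂ) : (descPoly c).degree < (N : WithBot ℕ) := by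
  refine (degree_sum_le _ _).trans_lt ?_
  rw [Finset.sup_lt_iff (by exact WithBot.bot_lt_coe N)]
  intro j _
  exact (degree_C_mul_X_pow_le _ _).trans_lt (by exact_mod_cast (by omega))

theorem coeff_descPoly {N : ℕ} (c : Fin N → ℂ) (n : Fin N) :
    (descPoly c).coeff (N - 1 - n) = c n := by
  simp only [descPoly, finsetSum_coeff, coeff_C_mul, coeff_X_pow]
  rw [Finset.sum_eq_single n]
  · simp
  · intro l _ hl
    rw [if_neg, mul_zero]
    intro h'
    exact hl (Fin.ext (by omega))
  · simp

theorem map_descPoly {N : ℕ} (c : Fin N → ℂ) (φ : ℂ →+* ℂ) :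
    (descPoly c).map φ = descPoly fun l => φ (c l) := by
  simp [descPoly, Polynomial.map_sum]

theorem map_conj_map_conj (P : ℂ[X]) : (P.map (starRingEnd ℂ)).map (starRingEnd ℂ) = P := by
  ext i
  simp

/-- The congruence `B ≡ A f` modulo `w ^ N`. -/
theorem coeff_descPoly_mul {N : ℕ} (f : PowerSeries ℂ) (v : Fin N → ℂ) (k : ℕ) (hk : k < N) :
    PowerSeries.coeff k (((X ^ N - descPoly v : ℂ[X]) : PowerSeries ℂ) * f -
      ((- descPoly (fun n : Fin N => ∑ l : Fin N,
        if (n : ℕ) ≤ l then PowerSeries.coeff (l - n) f * v l else 0) : ℂ[X]) : PowerSeries ℂ))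
      = 0 := by
  have h1 : ∀ y : Fin N → ℂ, (descPoly y).coeff k = y ⟨N - 1 - k, by omega⟩ := by
    intro y
    rw [← coeff_descPoly y]
    congr 1
    simp only
    omega
  rw [map_sub, Polynomial.coeff_coe, coeff_neg, h1, coe_sub, sub_mul, map_sub, coe_pow, coe_X,
    PowerSeries.coeff_X_pow_mul', if_neg (by omega), zero_sub, sub_neg_eq_add, neg_add_eq_zero]
  simp only [descPoly]
  rw [← coeToPowerSeries.ringHom_apply, map_sum, Finset.sum_mul, map_sum]
  refine Finset.sum_congr rfl fun l _ => ?_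
  rw [coeToPowerSeries.ringHom_apply, coe_mul, coe_C, coe_pow, coe_X, mul_assoc,
    PowerSeries.coeff_C_mul, PowerSeries.coeff_X_pow_mul']
  by_cases hl : N - 1 - k ≤ (l : ℕ)
  · rw [if_pos (by omega), if_pos hl, mul_comm]
    congr 3
    omega
  · rw [if_neg (by omega), if_neg hl, mul_zero]

/-- The congruence `a + b f ≡ 0` modulo `w ^ N`, a consequence of the Sylvester equation. -/
theorem IsSylvester.coeff_add_eq_zero {d : ℂ} {f : PowerSeries ℂ} {m : ℕ → ℕ → ℂ}
    (h : IsSylvester d f m) {N : ℕ} (c : Fin N → ℂ)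
    (hc : ∀ j : Fin N, ∑ l : Fin N, c l * m l j = if (j : ℕ) = 0 then -1 else 0)
    (k : ℕ) (hk : k < N) :
    PowerSeries.coeff k
      ((((- descPoly (fun n : Fin N => ∑ l : Fin N,
        if (n : ℕ) ≤ l then (starRingEnd ℂ) (PowerSeries.coeff (l - n) f) * c l else 0)).comp
          (X - C d) : ℂ[X]) : PowerSeries ℂ) * f +
        (((X ^ N - descPoly c).comp (X - C d) : ℂ[X]) : PowerSeries ℂ)) = 0 := by
  let p : PowerSeries ℂ := PowerSeries.X - PowerSeries.C d
  have hp : ((X - C d : ℂ[X]) : PowerSeries ℂ) = p := by simp [p]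
  have hcomp : ∀ y : Fin N → ℂ, (((descPoly y).comp (X - C d) : ℂ[X]) : PowerSeries ℂ) =
      ∑ l : Fin N, PowerSeries.C (y l) * p ^ (N - 1 - (l : ℕ)) := by
    intro y
    rw [← hp]
    rw [comp_X_sub_C_eq_taylor, descPoly, map_sum, ← coeToPowerSeries.ringHom_apply, map_sum]
    refine Finset.sum_congr rfl fun l _ => ?_
    rw [← comp_X_sub_C_eq_taylor, mul_comp, C_comp, pow_comp, X_comp,
      coeToPowerSeries.ringHom_apply, coe_mul, coe_C, coe_pow]
  let g : ℕ → PowerSeries ℂ := fun k => PowerSeries.mk (m k)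
  have hg : ∀ k, -p * g k + prev g k =
      (if k = 0 then 1 else 0) + PowerSeries.C ((starRingEnd ℂ) (PowerSeries.coeff k f)) * f := by
    intro k
    ext l
    have h1 := h k l
    have h2 : PowerSeries.coeff l (prev g k) = prev (fun i => m i l) k := by
      cases k <;> simp [g]
    have h3 : PowerSeries.coeff l (PowerSeries.X * g k) = prev (m k) l := by
      cases l <;> simp [g, PowerSeries.coeff_succ_X_mul]
    have h4 : -p * g k = PowerSeries.C d * g k - PowerSeries.X * g k := by simp only [p]; ring
    have h5 : PowerSeries.coeff l (if k = 0 then (1 : PowerSeries ℂ) else 0) =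
        (if k = 0 then 1 else 0) * (if l = 0 then 1 else 0) := by
      split_ifs <;> simp_all [PowerSeries.coeff_one]
    rw [h4, map_add, map_sub, map_add, h2, h3, PowerSeries.coeff_C_mul, PowerSeries.coeff_C_mul, h5,
      ← h1]
    simp only [g, PowerSeries.coeff_mk]
    ring
  have hmain : (((- descPoly (fun n : Fin N => ∑ l : Fin N,
        if (n : ℕ) ≤ l then (starRingEnd ℂ) (PowerSeries.coeff (l - n) f) * c l else 0)).comp
          (X - C d) : ℂ[X]) : PowerSeries ℂ) * f +
        (((X ^ N - descPoly c).comp (X - C d) : ℂ[X]) : PowerSeries ℂ) =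
      p ^ N * (1 + ∑ l : Fin N, PowerSeries.C (c l) * g l) := by
    have h1 : ∀ l : Fin N, PowerSeries.C (c l) * (p ^ N * g l) =
        - ∑ n : Fin N, (if (n : ℕ) ≤ l then PowerSeries.C (c l) * (p ^ (N - 1 - (n : ℕ)) *
          ((if (l : ℕ) - n = 0 then 1 else 0) +
            PowerSeries.C ((starRingEnd ℂ) (PowerSeries.coeff ((l : ℕ) - n) f)) * f)) else 0) := by
      intro l
      have h2 := sum_telescope p g l (N - 1) (by omega)
      rw [show N - 1 + 1 = N by omega] at h2
      rw [← neg_eq_iff_eq_neg, ← mul_neg, ← neg_mul, ← h2, Finset.mul_sum,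
        Fin.sum_univ_eq_sum_range (fun n => if n ≤ (l : ℕ) then PowerSeries.C (c l) *
          (p ^ (N - 1 - n) * ((if (l : ℕ) - n = 0 then 1 else 0) +
            PowerSeries.C ((starRingEnd ℂ) (PowerSeries.coeff ((l : ℕ) - n) f)) * f)) else 0),
        ← Finset.sum_filter]
      refine Finset.sum_congr ?_ fun n _ => ?_
      · ext n
        simp only [Finset.mem_filter, Finset.mem_range]
        omega
      · rw [hg]
    rw [neg_comp, coe_neg, hcomp, sub_comp, coe_sub, hcomp, pow_comp, X_comp, coe_pow, hp, mul_add,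
      mul_one, Finset.mul_sum, Finset.sum_congr rfl fun l _ => mul_left_comm (p ^ N) _ _,
      Finset.sum_congr rfl fun l _ => h1 l, Finset.sum_neg_distrib, Finset.sum_comm]
    have h3 : ∀ n : Fin N, ∑ l : Fin N, (if (n : ℕ) ≤ l then PowerSeries.C (c l) *
        (p ^ (N - 1 - (n : ℕ)) * ((if (l : ℕ) - n = 0 then 1 else 0) +
            PowerSeries.C ((starRingEnd ℂ) (PowerSeries.coeff ((l : ℕ) - n) f)) * f)) else 0) =
        PowerSeries.C (c n) * p ^ (N - 1 - (n : ℕ)) +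
        PowerSeries.C (∑ l : Fin N,
        if (n : ℕ) ≤ l then (starRingEnd ℂ) (PowerSeries.coeff (l - n) f) * c l else 0) *
          p ^ (N - 1 - (n : ℕ)) * f := by
      intro n
      have h4 : PowerSeries.C (c n) * p ^ (N - 1 - (n : ℕ)) =
          ∑ l : Fin N, if l = n then PowerSeries.C (c l) * p ^ (N - 1 - (n : ℕ)) else 0 := by
        simp
      rw [h4, map_sum, Finset.sum_mul, Finset.sum_mul, ← Finset.sum_add_distrib]
      refine Finset.sum_congr rfl fun l _ => ?_
      by_cases hl : (n : ℕ) ≤ l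
      · by_cases hln : l = n
        · subst hln
          simp
          ring
        · have : ¬ ((l : ℕ) - n = 0) := fun h' => hln (Fin.ext (by omega))
          simp [hl, hln, this]
          ring
      · have : l ≠ n := fun h' => hl (by rw [h'])
        simp [hl, this]
    rw [Finset.sum_congr rfl fun n _ => h3 n, Finset.sum_add_distrib, ← Finset.sum_mul]
    ring
  rw [hmain]
  have hX : (PowerSeries.X : PowerSeries ℂ) ^ N ∣ 1 + ∑ l : Fin N, PowerSeries.C (c l) * g l := by
    rw [PowerSeries.X_pow_dvd_iff]
    intro j hj
    have := hc ⟨j, hj⟩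
    simp only at this
    simp only [map_add, map_sum, PowerSeries.coeff_C_mul, g, PowerSeries.coeff_mk, this,
      PowerSeries.coeff_one]
    split_ifs <;> simp
  exact PowerSeries.X_pow_dvd_iff.mp (hX.mul_left _) k hk

theorem coeff_taylor_of_natDegree_le (P : ℂ[X]) (y : ℂ) {n : ℕ} (hn : P.natDegree ≤ n) :
    (taylor y P).coeff n = P.coeff n := by
  rcases hn.eq_or_lt with rfl | h
  · exact coeff_taylor_natDegree ..
  · rw [coeff_eq_zero_of_natDegree_lt h, coeff_eq_zero_of_natDegree_lt]
    rwa [natDegree_taylor]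

theorem IsSylvester.exists_darbouxPair {z : ℂ} {f : PowerSeries ℂ} {m : ℕ → ℕ → ℂ}
    (hz : z.im ≠ 0) (h : IsSylvester ((starRingEnd ℂ) z - z) f m) {N : ℕ} (hN : 0 < N) :
    ∃ a b : ℂ[X], IsDarbouxPair N z f a b ∧ b.coeff (N - 1) =
      ∑ l : Fin N, (Matrix.of fun k l : Fin N => m k l)⁻¹ ⟨0, hN⟩ l *
        (starRingEnd ℂ) (PowerSeries.coeff l f) := by
  set d := (starRingEnd ℂ) z - z with hd_def
  have hd : (starRingEnd ℂ) d = -d := by simp [hd_def]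
  have hd0 : d ≠ 0 := by
    intro h0
    apply hz
    have := congrArg Complex.im h0
    simp [hd_def] at this
    linarith
  set M : Matrix (Fin N) (Fin N) ℂ := Matrix.of fun k l : Fin N => m k l with hM
  have hdet := h.isUnit_det hd hd0 N
  rw [← hM] at hdet
  -- `M` is skew-Hermitian, because its conjugate transpose with the opposite sign solves the same
  -- Sylvester equation.
  have hskew : M.conjTranspose = -M := by
    ext i j
    simp only [hM, Matrix.conjTranspose_apply, Matrix.of_apply, Matrix.neg_apply]
    exact h.conj_eq hd hd0 _ _
  have hskewinv : ∀ i j, (starRingEnd ℂ) (M⁻¹ i j) = - M⁻¹ j i := by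
    intro i j
    have h1 : (M⁻¹).conjTranspose = - M⁻¹ := by
      rw [Matrix.conjTranspose_nonsing_inv, hskew]
      refine Matrix.inv_eq_left_inv ?_
      rw [neg_mul_neg, Matrix.nonsing_inv_mul _ hdet]
    have := congrFun (congrFun h1 j) i
    simpa using this
  -- The first column of `M⁻¹` gives the coefficients of `a⋆`; those of `b⋆` are forced by
  -- `b⋆ ≡ a⋆ f`.
  let v : Fin N → ℂ := fun l => M⁻¹ l ⟨0, hN⟩
  have hv : ∀ l : Fin N, ∑ k : Fin N, (starRingEnd ℂ) (v k) * m k l =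
      if (l : ℕ) = 0 then -1 else 0 := by
    intro l
    have h1 := congrFun (congrFun (Matrix.nonsing_inv_mul M hdet) ⟨0, hN⟩) l
    simp only [v, hskewinv]
    rw [Matrix.mul_apply] at h1
    simp only [neg_mul, Finset.sum_neg_distrib]
    have h2 : ∑ k : Fin N, M⁻¹ ⟨0, hN⟩ k * m k l = ∑ k : Fin N, M⁻¹ ⟨0, hN⟩ k * M k l := rfl
    rw [h2, h1, Matrix.one_apply]
    simp only [Fin.ext_iff, eq_comm (a := 0)]
    split_ifs <;> simp
  let A : ℂ[X] := X ^ N - descPoly v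
  let y : Fin N → ℂ := fun n => ∑ l : Fin N,
    if (n : ℕ) ≤ l then PowerSeries.coeff (l - n) f * v l else 0
  let B : ℂ[X] := - descPoly y
  let a := (A.map (starRingEnd ℂ)).comp (X - C ((starRingEnd ℂ) z))
  let b := (B.map (starRingEnd ℂ)).comp (X - C ((starRingEnd ℂ) z))
  have hAm : A.Monic := monic_X_pow_sub (degree_descPoly_lt v)
  have hAN : A.natDegree = N := by
    have : A.degree = N := by
      rw [show A = X ^ N - descPoly v from rfl, degree_sub_eq_left_of_degree_lt] <;>
        rw [degree_X_pow]
      exact degree_descPoly_lt v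
    exact natDegree_eq_of_degree_eq_some this
  have hBN : B.degree < (N : WithBot ℕ) := by
    rw [show B = - descPoly y from rfl, degree_neg]; exact degree_descPoly_lt y
  have htay : ∀ P : ℂ[X], taylor z
      (((P.map (starRingEnd ℂ)).comp (X - C ((starRingEnd ℂ) z))).map (starRingEnd ℂ)) = P := by
    intro P
    rw [map_comp, map_conj_map_conj, Polynomial.map_sub, map_X, map_C, Complex.conj_conj,
      taylor_comp_sub]
    simp
  have hAmap : A.map (starRingEnd ℂ) = X ^ N - descPoly fun l => (starRingEnd ℂ) (v l) := by
    rw [Polynomial.map_sub, map_descPoly, Polynomial.map_pow, map_X]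
  have hBmap : B.map (starRingEnd ℂ) = - descPoly (fun n : Fin N => ∑ l : Fin N,
        if (n : ℕ) ≤ l then (starRingEnd ℂ) (PowerSeries.coeff (l - n) f) *
          (starRingEnd ℂ) (v l) else 0) := by
    rw [Polynomial.map_neg, map_descPoly]
    congr 2
    ext n
    rw [map_sum]
    exact Finset.sum_congr rfl fun l _ => by split_ifs <;> simp
  refine ⟨a, b, ⟨(hAm.map _).comp_X_sub_C _, ?_, ?_, ?_, ?_⟩, ?_⟩
  · rw [natDegree_comp, natDegree_X_sub_C, mul_one, natDegree_map, hAN]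
  · rw [show b = taylor (-(starRingEnd ℂ) z) (B.map (starRingEnd ℂ)) from
      comp_X_sub_C_eq_taylor _ _, degree_taylor, degree_map]
    exact hBN
  · intro k hk
    rw [taylor_comp_sub, taylor_comp_sub, hAmap, hBmap]
    exact h.coeff_add_eq_zero _ hv k hk
  · intro k hk
    rw [htay, htay]
    exact coeff_descPoly_mul f v k hk
  · have hd1 : (B.map (starRingEnd ℂ)).natDegree ≤ N - 1 := by
      rw [natDegree_map]
      rcases eq_or_ne B 0 with h0 | h0
      · simp [h0]
      · have := (natDegree_lt_iff_degree_lt h0).mpr hBN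
        omega
    rw [show b = taylor (-(starRingEnd ℂ) z) (B.map (starRingEnd ℂ)) from
      comp_X_sub_C_eq_taylor _ _, coeff_taylor_of_natDegree_le _ _ hd1, hBmap, coeff_neg]
    have := coeff_descPoly (fun n : Fin N => ∑ l : Fin N,
        if (n : ℕ) ≤ l then (starRingEnd ℂ) (PowerSeries.coeff (l - n) f) *
          (starRingEnd ℂ) (v l) else 0) ⟨0, hN⟩
    simp only [Nat.sub_zero] at this
    rw [this]
    simp [v, hskewinv, mul_comm]

/-! ### The matrix `M` of the soliton -/

/-- The coefficients of `1 / (d + u - w)`. -/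
noncomputable def kernelCoeff (d : ℂ) (k l : ℕ) : ℂ :=
  (-1) ^ k * ((k + l).choose k : ℂ) / d ^ (k + l + 1)

theorem kernelCoeff_sylvester {d : ℂ} (hd : d ≠ 0) (k l : ℕ) :
    d * kernelCoeff d k l + prev (fun i => kernelCoeff d i l) k - prev (kernelCoeff d k) l =
      (if k = 0 then 1 else 0) * (if l = 0 then 1 else 0) := by
  rcases k with _ | k <;> rcases l with _ | l
  · simp [kernelCoeff, hd]
  · simp [kernelCoeff]
    field_simp
    ring
  · simp [kernelCoeff, pow_succ]
    field_simp
    ring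
  · have h1 : ((k + 1 + (l + 1)).choose (k + 1) : ℂ) =
        ((k + (l + 1)).choose k : ℂ) + ((k + 1 + l).choose (k + 1) : ℂ) := by
      rw [show k + 1 + (l + 1) = (k + l + 1) + 1 by ring, Nat.choose_succ_succ]
      push_cast
      congr 3; ring
    simp only [kernelCoeff, prev_succ, h1, pow_succ, Nat.add_eq_zero_iff, one_ne_zero, and_false,
      if_false, mul_zero]
    rw [show k + 1 + (l + 1) = k + l + 2 by ring, show k + (l + 1) = k + l + 1 by ring,
      show k + 1 + l = k + l + 1 by ring]
    field_simp
    ring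

/-- The coefficient array of `(1 + f̄(u) f(w)) / (d + u - w)`. -/
noncomputable def gramCoeff (d : ℂ) (f : PowerSeries ℂ) (k l : ℕ) : ℂ :=
  PowerSeries.coeff l (PowerSeries.coeff k
    ((PowerSeries.mk fun i => PowerSeries.mk fun j => kernelCoeff d i j) *
      (PowerSeries.mk fun i =>
        PowerSeries.C ((starRingEnd ℂ) (PowerSeries.coeff i f)) * f + if i = 0 then 1 else 0)))

theorem gramCoeff_eq_sum (d : ℂ) (f : PowerSeries ℂ) (k l : ℕ) :
    gramCoeff d f k l = ∑ p ∈ antidiagonal k, ∑ r ∈ antidiagonal l, kernelCoeff d p.1 r.1 *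
      ((starRingEnd ℂ) (PowerSeries.coeff p.2 f) * PowerSeries.coeff r.2 f +
        (if p.2 = 0 then 1 else 0) * (if r.2 = 0 then 1 else 0)) := by
  have h5 : ∀ k l : ℕ, PowerSeries.coeff l (if k = 0 then (1 : PowerSeries ℂ) else 0) =
      (if k = 0 then 1 else 0) * (if l = 0 then 1 else 0) := by
    intro k l
    split_ifs <;> simp_all [PowerSeries.coeff_one]
  rw [gramCoeff, PowerSeries.coeff_mul, map_sum]
  refine Finset.sum_congr rfl fun p _ => ?_
  rw [PowerSeries.coeff_mul]
  simp only [PowerSeries.coeff_mk, map_add, PowerSeries.coeff_C_mul, h5]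

/-- Multiplication by `d + u - w` in `ℂ⟦w⟧⟦u⟧`, where it inverts the series of `kernelCoeff`. -/
theorem isSylvester_gramCoeff {d : ℂ} (hd : d ≠ 0) (f : PowerSeries ℂ) :
    IsSylvester d f (gramCoeff d f) := by
  intro k l
  set S : PowerSeries (PowerSeries ℂ) :=
    PowerSeries.mk fun i => PowerSeries.mk fun j => kernelCoeff d i j with hS
  set K : PowerSeries (PowerSeries ℂ) := PowerSeries.mk fun i =>
        PowerSeries.C ((starRingEnd ℂ) (PowerSeries.coeff i f)) * f + if i = 0 then 1 else 0 with hK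
  have hcoef : ∀ (T : PowerSeries (PowerSeries ℂ)) (k l : ℕ),
      PowerSeries.coeff l (PowerSeries.coeff k
        ((PowerSeries.C (PowerSeries.C d) + PowerSeries.X - PowerSeries.C PowerSeries.X) * T)) =
      d * PowerSeries.coeff l (PowerSeries.coeff k T) +
        prev (fun i => PowerSeries.coeff l (PowerSeries.coeff i T)) k -
        prev (fun j => PowerSeries.coeff j (PowerSeries.coeff k T)) l := by
    intro T k l
    rw [sub_mul, add_mul, map_sub, map_add, PowerSeries.coeff_C_mul, PowerSeries.coeff_C_mul,
      map_sub, map_add, PowerSeries.coeff_C_mul]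
    congr 1
    · congr 1
      cases k with
      | zero => simp
      | succ k => simp [PowerSeries.coeff_succ_X_mul]
    · cases l with
      | zero => simp
      | succ k => simp [PowerSeries.coeff_succ_X_mul]
  have h1 : (PowerSeries.C (PowerSeries.C d) + PowerSeries.X - PowerSeries.C PowerSeries.X) * S
      = 1 := by
    ext k l
    rw [hcoef]
    simp only [hS, PowerSeries.coeff_mk, PowerSeries.coeff_one]
    refine (kernelCoeff_sylvester hd k l).trans ?_
    split_ifs <;> simp_all [PowerSeries.coeff_one]
  have h2 := hcoef (S * K) k l
  rw [← mul_assoc, h1, one_mul] at h2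
  refine h2.symm.trans ?_
  simp only [hK, PowerSeries.coeff_mk, map_add, PowerSeries.coeff_C_mul]
  rw [add_comm]
  congr 1
  split_ifs <;> simp_all [PowerSeries.coeff_one]

/-- The Taylor series of `exp (2 θ)` at `λ₁`. -/
noncomputable def phaseSeries {N : ℕ} (γ δ : ℝ) (lam1 : ℂ) (a : Fin N → ℂ) (x t : ℝ) :
    PowerSeries ℂ :=
  PowerSeries.mk fun k => Hirota.phiCoeff γ δ lam1 a x t k 0

theorem matM_eq {N : ℕ} (γ δ : ℝ) (lam1 : ℂ) (a : Fin N → ℂ) (x t : ℝ) :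
    Hirota.matM γ δ lam1 a x t = Matrix.of fun k l : Fin N =>
      gramCoeff ((starRingEnd ℂ) lam1 - lam1) (phaseSeries γ δ lam1 a x t) k l := by
  ext k l
  have hphi : ∀ j, Hirota.phiCoeff γ δ lam1 a x t j 0 =
      PowerSeries.coeff j (phaseSeries γ δ lam1 a x t) := by
    intro j; simp [phaseSeries]
  have hphi1 : ∀ j, Hirota.phiCoeff γ δ lam1 a x t j 1 = if j = 0 then 1 else 0 := by
    intro j; simp [Hirota.phiCoeff]
  rw [Matrix.of_apply, gramCoeff_eq_sum]
  rw [← sum_fin_eq_antidiagonal (N := N) k (fun p p' => ∑ r ∈ antidiagonal (l : ℕ),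
      kernelCoeff ((starRingEnd ℂ) lam1 - lam1) p r.1 *
      ((starRingEnd ℂ) (PowerSeries.coeff p' (phaseSeries γ δ lam1 a x t)) *
        PowerSeries.coeff r.2 (phaseSeries γ δ lam1 a x t) +
        (if p' = 0 then 1 else 0) * (if r.2 = 0 then 1 else 0))) (fun i j hi hj => by omega)]
  simp only [Hirota.matM, Matrix.mul_apply, Matrix.conjTranspose_apply, Fintype.sum_prod_type,
    Fin.sum_univ_two, Hirota.matX, Hirota.matS, Matrix.of_apply, hphi, hphi1]
  simp only [Fin.isValue, zero_ne_one, one_ne_zero, if_true, if_false, mul_zero, add_zero, zero_add]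
  simp only [Finset.sum_mul, Finset.sum_add_distrib.symm]
  rw [Finset.sum_comm]
  refine Finset.sum_congr rfl fun p _ => ?_
  simp only [← Fin.val_fin_le]
  by_cases hp : (p : ℕ) ≤ k
  · simp only [if_pos hp]
    rw [← sum_fin_eq_antidiagonal (N := N) l (fun r r' =>
      kernelCoeff ((starRingEnd ℂ) lam1 - lam1) p r *
      ((starRingEnd ℂ) (PowerSeries.coeff (k - p) (phaseSeries γ δ lam1 a x t)) *
        PowerSeries.coeff r' (phaseSeries γ δ lam1 a x t) +
        (if (k : ℕ) - p = 0 then 1 else 0) * (if r' = 0 then 1 else 0)))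
      (fun i j hi hj => by omega)]
    refine Finset.sum_congr rfl fun r _ => ?_
    simp only [kernelCoeff]
    split_ifs <;> simp <;> ring
  · simp [hp]

theorem exists_darbouxPair_soliton {N : ℕ} (hN : 1 ≤ N) (γ δ : ℝ) (lam1 : ℂ)
    (hlam1 : lam1.im ≠ 0) (a : Fin N → ℂ) (x t : ℝ) :
    ∃ A B : ℂ[X], IsDarbouxPair N lam1 (phaseSeries γ δ lam1 a x t) A B ∧
      Hirota.soliton γ δ lam1 a x t = 2 * B.coeff (N - 1) := by
  have hd : (starRingEnd ℂ) lam1 - lam1 ≠ 0 := by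
    intro h0
    apply hlam1
    have := congrArg Complex.im h0
    simp at this
    linarith
  obtain ⟨A, B, h, hB⟩ := (isSylvester_gramCoeff hd
    (phaseSeries γ δ lam1 a x t)).exists_darbouxPair hlam1 hN
  refine ⟨A, B, h, ?_⟩
  rw [hB, ← matM_eq, Hirota.soliton, Matrix.mul_apply]
  congr 1
  refine Finset.sum_congr rfl fun l _ => ?_
  rw [Matrix.mul_apply, Finset.sum_eq_single ⟨0, hN⟩]
  · simp [Hirota.matY, Hirota.phiCoeff, phaseSeries]
  · intro b _ hb
    have : (b : ℕ) ≠ 0 := fun h' => hb (Fin.ext h')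
    simp [Hirota.matY, Hirota.phiCoeff, this]
  · simp

/-! ### Unitarity and compactness -/

theorem X_sub_C_pow_dvd_iff (z : ℂ) (n : ℕ) (P : ℂ[X]) :
    (X - C z) ^ n ∣ P ↔ ∀ k < n, (taylor z P).coeff k = 0 := by
  rw [← X_pow_dvd_iff, taylor_apply, dvd_comp_X_add_C_iff, pow_comp, X_comp]

theorem coeff_taylor_X_sub_C_pow_mul (z : ℂ) (k : ℕ) (Q : ℂ[X]) :
    (taylor z ((X - C z) ^ k * Q)).coeff k = Q.eval z := by
  rw [taylor_mul, taylor_pow, ← taylor_coeff_zero]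
  have : taylor z (X - C z) = X := by simp
  rw [this]
  simpa using coeff_X_pow_mul (taylor z Q) k 0

theorem taylor_map_conj (z : ℂ) (P : ℂ[X]) :
    taylor z (P.map (starRingEnd ℂ)) =
      (taylor ((starRingEnd ℂ) z) P).map (starRingEnd ℂ) := by
  rw [taylor_apply, taylor_apply, map_comp]
  simp

theorem X_sub_C_pow_dvd_map_conj_iff (z : ℂ) (n : ℕ) (P : ℂ[X]) :
    (X - C z) ^ n ∣ P.map (starRingEnd ℂ) ↔ (X - C ((starRingEnd ℂ) z)) ^ n ∣ P := by
  rw [X_sub_C_pow_dvd_iff, X_sub_C_pow_dvd_iff]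
  refine forall₂_congr fun k _ => ?_
  rw [taylor_map_conj, coeff_map, map_eq_zero]

theorem isCoprime_X_sub_C_pow {z : ℂ} (hz : z.im ≠ 0) (m n : ℕ) :
    IsCoprime ((X - C z) ^ m : ℂ[X]) ((X - C ((starRingEnd ℂ) z)) ^ n) := by
  refine IsCoprime.pow (isCoprime_X_sub_C_of_isUnit_sub ?_)
  rw [isUnit_iff_ne_zero]
  intro h0
  apply hz
  have := congrArg Complex.im h0
  simp at this
  linarith

namespace IsDarbouxPair

variable {N : ℕ} {z : ℂ} {f : PowerSeries ℂ} {a b : ℂ[X]}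

theorem dvd_add (h : IsDarbouxPair N z f a b) : (PowerSeries.X : PowerSeries ℂ) ^ N ∣
    (taylor z b : PowerSeries ℂ) * f + (taylor z a : PowerSeries ℂ) :=
  PowerSeries.X_pow_dvd_iff.mpr h.coeff_add

theorem dvd_sub (h : IsDarbouxPair N z f a b) : (PowerSeries.X : PowerSeries ℂ) ^ N ∣
    (taylor z (a.map (starRingEnd ℂ)) : PowerSeries ℂ) * f -
      (taylor z (b.map (starRingEnd ℂ)) : PowerSeries ℂ) :=
  PowerSeries.X_pow_dvd_iff.mpr h.coeff_sub

theorem degree_eq (h : IsDarbouxPair N z f a b) : a.degree = N := by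
  rw [degree_eq_natDegree h.monic.ne_zero, h.natDegree_eq]

theorem neg_coeff_left (h : IsDarbouxPair N z f a b) (k : ℕ) (hk : k < N) :
    -(taylor z a).coeff k =
      ∑ p ∈ antidiagonal k, (taylor z b).coeff p.1 * PowerSeries.coeff p.2 f := by
  have := h.coeff_add k hk
  rw [map_add, PowerSeries.coeff_mul] at this
  simp only [Polynomial.coeff_coe] at this
  exact (eq_neg_of_add_eq_zero_left this).symm

theorem neg_coeff_right (h : IsDarbouxPair N z f a b) {fi : PowerSeries ℂ} (hf : f * fi = 1)
    (k : ℕ) (hk : k < N) :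
    -(taylor z b).coeff k =
      ∑ p ∈ antidiagonal k, (taylor z a).coeff p.1 * PowerSeries.coeff p.2 fi := by
  have h1 := h.dvd_add.mul_right fi
  rw [add_mul, mul_assoc, hf, mul_one] at h1
  have := PowerSeries.X_pow_dvd_iff.mp h1 k hk
  rw [map_add, PowerSeries.coeff_mul] at this
  simp only [Polynomial.coeff_coe] at this
  exact (eq_neg_of_add_eq_zero_right this).symm

theorem coeff_conj_right (h : IsDarbouxPair N z f a b) (k : ℕ) (hk : k < N) :
    (taylor z (b.map (starRingEnd ℂ))).coeff k = ∑ p ∈ antidiagonal k,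
      (taylor z (a.map (starRingEnd ℂ))).coeff p.1 * PowerSeries.coeff p.2 f := by
  have := h.coeff_sub k hk
  rw [map_sub, PowerSeries.coeff_mul] at this
  simp only [Polynomial.coeff_coe] at this
  exact (sub_eq_zero.mp this).symm

theorem coeff_conj_left (h : IsDarbouxPair N z f a b) {fi : PowerSeries ℂ} (hf : f * fi = 1)
    (k : ℕ) (hk : k < N) :
    (taylor z (a.map (starRingEnd ℂ))).coeff k = ∑ p ∈ antidiagonal k,
      (taylor z (b.map (starRingEnd ℂ))).coeff p.1 * PowerSeries.coeff p.2 fi := by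
  have h1 := h.dvd_sub.mul_right fi
  rw [sub_mul, mul_assoc, hf, mul_one] at h1
  have := PowerSeries.X_pow_dvd_iff.mp h1 k hk
  rw [map_sub, PowerSeries.coeff_mul] at this
  simp only [Polynomial.coeff_coe] at this
  exact sub_eq_zero.mp this

/-- The Darboux matrix is unitary on the real axis. The left side is congruent to
`a a⋆ + b a⋆ f ≡ 0` modulo `(λ - z) ^ N`, and by symmetry modulo `(λ - z̄) ^ N`; it is monic of
degree `2 N`. -/
theorem mul_conj_add (h : IsDarbouxPair N z f a b) (hz : z.im ≠ 0) :
    a * a.map (starRingEnd ℂ) + b * b.map (starRingEnd ℂ) =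
      (X - C z) ^ N * (X - C ((starRingEnd ℂ) z)) ^ N := by
  set W := a * a.map (starRingEnd ℂ) + b * b.map (starRingEnd ℂ) with hW
  have hWconj : W.map (starRingEnd ℂ) = W := by
    rw [hW, Polynomial.map_add, Polynomial.map_mul, Polynomial.map_mul, map_conj_map_conj,
      map_conj_map_conj, mul_comm, mul_comm b]
  have h1 : (X - C z) ^ N ∣ W := by
    rw [X_sub_C_pow_dvd_iff]
    have h2 : (PowerSeries.X : PowerSeries ℂ) ^ N ∣ (taylor z W : PowerSeries ℂ) := by
      have h3 : (taylor z W : PowerSeries ℂ) =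
          ((taylor z b : PowerSeries ℂ) * f + (taylor z a : PowerSeries ℂ)) *
            (taylor z (a.map (starRingEnd ℂ)) : PowerSeries ℂ) -
          ((taylor z (a.map (starRingEnd ℂ)) : PowerSeries ℂ) * f -
            (taylor z (b.map (starRingEnd ℂ)) : PowerSeries ℂ)) * (taylor z b : PowerSeries ℂ) := by
        rw [hW, map_add, taylor_mul, taylor_mul, coe_add, coe_mul, coe_mul]
        ring
      rw [h3]
      exact (h.dvd_add.mul_right _).sub (h.dvd_sub.mul_right _)
    intro k hk
    simpa using PowerSeries.X_pow_dvd_iff.mp h2 k hk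
  have h2 : (X - C ((starRingEnd ℂ) z)) ^ N ∣ W := by
    rw [← X_sub_C_pow_dvd_map_conj_iff, hWconj]; exact h1
  have h3 := (isCoprime_X_sub_C_pow hz N N).mul_dvd h1 h2
  have hdeg : (b * b.map (starRingEnd ℂ)).degree < (a * a.map (starRingEnd ℂ)).degree := by
    rw [degree_mul, degree_mul, degree_map, degree_map, h.degree_eq]
    rcases eq_or_ne b 0 with h0 | h0
    · rw [h0, degree_zero, WithBot.bot_add]
      exact WithBot.bot_lt_coe _
    · have := h.degree_lt
      rw [degree_eq_natDegree h0] at this ⊢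
      norm_cast at this ⊢
      omega
  have hWm : W.Monic := (h.monic.mul (h.monic.map _)).add_of_left hdeg
  refine eq_of_monic_of_dvd_of_natDegree_le (((monic_X_sub_C z).pow N).mul
    ((monic_X_sub_C _).pow N)) hWm h3 ?_
  rw [hW, natDegree_add_eq_left_of_degree_lt hdeg, natDegree_mul h.monic.ne_zero
    (h.monic.map _).ne_zero, natDegree_map, h.natDegree_eq,
    natDegree_mul (pow_ne_zero _ (X_sub_C_ne_zero _)) (pow_ne_zero _ (X_sub_C_ne_zero _)),
    natDegree_pow, natDegree_pow, natDegree_X_sub_C, natDegree_X_sub_C, mul_one]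

theorem norm_eval_sq_add (h : IsDarbouxPair N z f a b) (hz : z.im ≠ 0) (x : ℝ) :
    ‖a.eval (x : ℂ)‖ ^ 2 + ‖b.eval (x : ℂ)‖ ^ 2 = (‖(x : ℂ) - z‖ ^ N) ^ 2 := by
  have h1 := congrArg (eval (x : ℂ)) (h.mul_conj_add hz)
  have h2 : ∀ P : ℂ[X], (P.map (starRingEnd ℂ)).eval (x : ℂ) =
      (starRingEnd ℂ) (P.eval (x : ℂ)) := by
    intro P
    have := eval_map_apply (starRingEnd ℂ) (x : ℂ) (p := P)
    rwa [Complex.conj_ofReal] at this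
  have h3 : (x : ℂ) - (starRingEnd ℂ) z = (starRingEnd ℂ) ((x : ℂ) - z) := by simp
  simp only [eval_add, eval_mul, h2, eval_pow, eval_sub, eval_X, eval_C, h3, ← map_pow,
    Complex.mul_conj'] at h1
  rw [norm_pow] at h1
  exact_mod_cast h1

theorem norm_eval_left_le (h : IsDarbouxPair N z f a b) (hz : z.im ≠ 0) (x : ℝ) :
    ‖a.eval (x : ℂ)‖ ≤ ‖(x : ℂ) - z‖ ^ N := by
  refine le_of_sq_le_sq ?_ (by positivity)
  have := h.norm_eval_sq_add hz x
  nlinarith [sq_nonneg ‖b.eval (x : ℂ)‖]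

theorem norm_eval_right_le (h : IsDarbouxPair N z f a b) (hz : z.im ≠ 0) (x : ℝ) :
    ‖b.eval (x : ℂ)‖ ≤ ‖(x : ℂ) - z‖ ^ N := by
  refine le_of_sq_le_sq ?_ (by positivity)
  have := h.norm_eval_sq_add hz x
  nlinarith [sq_nonneg ‖a.eval (x : ℂ)‖]

/-- Multiplication of `f` by a unimodular constant. -/
theorem gauge (h : IsDarbouxPair N z f a b) {χ : ℂ} (hχ : ‖χ‖ = 1) :
    IsDarbouxPair N z (PowerSeries.C ((starRingEnd ℂ) χ) * f) a (C χ * b) := by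
  have hχ1 : χ * (starRingEnd ℂ) χ = 1 := by rw [Complex.mul_conj']; simp [hχ]
  have hχ0 : χ ≠ 0 := by rintro rfl; simp at hχ
  refine ⟨h.monic, h.natDegree_eq, ?_, ?_, ?_⟩
  · rw [degree_C_mul hχ0]; exact h.degree_lt
  · intro k hk
    have : ((taylor z (C χ * b) : ℂ[X]) : PowerSeries ℂ) * (PowerSeries.C ((starRingEnd ℂ) χ) * f) =
        PowerSeries.C (χ * (starRingEnd ℂ) χ) * ((taylor z b : PowerSeries ℂ) * f) := by
      rw [taylor_mul, taylor_C, coe_mul, coe_C, map_mul]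
      ring
    rw [this, hχ1, map_one, one_mul]
    exact h.coeff_add k hk
  · intro k hk
    have : (taylor z (a.map (starRingEnd ℂ)) : PowerSeries ℂ) *
        (PowerSeries.C ((starRingEnd ℂ) χ) * f) -
        (taylor z ((C χ * b).map (starRingEnd ℂ)) : PowerSeries ℂ) =
        PowerSeries.C ((starRingEnd ℂ) χ) *
          ((taylor z (a.map (starRingEnd ℂ)) : PowerSeries ℂ) * f -
        (taylor z (b.map (starRingEnd ℂ)) : PowerSeries ℂ)) := by
      rw [Polynomial.map_mul, map_C, taylor_mul, taylor_C, coe_mul, coe_C]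
      ring
    rw [this, PowerSeries.coeff_C_mul, h.coeff_sub k hk, mul_zero]

end IsDarbouxPair

/-- Polynomials of bounded degree that are bounded at every real point converge along every
ultrafilter, by Lagrange interpolation at the nodes `0, …, n - 1`. The convergence is that of all
linear functionals. -/
theorem exists_tendsto_of_bounded {ι : Type*} (u : Ultrafilter ι) {n : ℕ} {P : ι → ℂ[X]}
    (hdeg : ∀ t, (P t).degree < (n : WithBot ℕ))
    (hbdd : ∀ x : ℝ, ∃ K : ℝ, ∀ t, ‖(P t).eval (x : ℂ)‖ ≤ K) :
    ∃ Q : ℂ[X], Q.degree < (n : WithBot ℕ) ∧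
      ∀ φ : ℂ[X] →ₗ[ℂ] ℂ, Tendsto (fun t => φ (P t)) u (𝓝 (φ Q)) := by
  have hlim : ∀ i : ℕ, ∃ c : ℂ, Tendsto (fun t => (P t).eval (i : ℂ)) u (𝓝 c) := by
    intro i
    obtain ⟨K, hK⟩ := hbdd i
    have h1 : (Metric.closedBall (0 : ℂ) K) ∈ u.map (fun t => (P t).eval (i : ℂ)) := by
      rw [Ultrafilter.mem_map]
      refine Filter.mem_of_superset Filter.univ_mem fun t _ => ?_
      simpa using hK t
    obtain ⟨c, _, hc⟩ := (isCompact_closedBall (0 : ℂ) K).ultrafilter_le_nhds' _ h1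
    exact ⟨c, hc⟩
  choose c hc using hlim
  let v : ℕ → ℂ := fun i => (i : ℂ)
  have hv : Set.InjOn v (Finset.range n) := fun i _ j _ h => Nat.cast_injective h
  have hval : ∀ (φ : ℂ[X] →ₗ[ℂ] ℂ) (r : ℕ → ℂ), φ (Lagrange.interpolate (Finset.range n) v r) =
      ∑ i ∈ Finset.range n, r i * φ (Lagrange.basis (Finset.range n) v i) := by
    intro φ r
    rw [Lagrange.interpolate_apply, map_sum]
    refine Finset.sum_congr rfl fun i _ => ?_
    rw [← smul_eq_C_mul, map_smul, smul_eq_mul]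
  refine ⟨Lagrange.interpolate (Finset.range n) v c, ?_, fun φ => ?_⟩
  · simpa using Lagrange.degree_interpolate_lt (r := c) hv
  · have h1 : ∀ t, φ (P t) = ∑ i ∈ Finset.range n,
        (P t).eval (i : ℂ) * φ (Lagrange.basis (Finset.range n) v i) := by
      intro t
      rw [← hval φ (fun i => (P t).eval (i : ℂ))]
      congr 1
      exact Lagrange.eq_interpolate hv (by simpa using hdeg t)
    rw [hval]
    simp only [h1]
    exact tendsto_finsetSum _ fun i _ => (hc i).mul_const _

/-- The limit of a family of Darboux pairs along an ultrafilter. -/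
theorem exists_limit_pair {ι : Type*} (u : Ultrafilter ι) {N : ℕ} {z : ℂ} (hz : z.im ≠ 0)
    {f : ι → PowerSeries ℂ} {a b : ι → ℂ[X]} (h : ∀ t, IsDarbouxPair N z (f t) (a t) (b t)) :
    ∃ A B : ℂ[X], A.Monic ∧ A.natDegree = N ∧ B.degree < (N : WithBot ℕ) ∧
      (∀ k, Tendsto (fun t => (b t).coeff k) u (𝓝 (B.coeff k))) ∧
      (∀ k, Tendsto (fun t => (taylor z (a t)).coeff k) u (𝓝 ((taylor z A).coeff k))) ∧
      (∀ k, Tendsto (fun t => (taylor z (b t)).coeff k) u (𝓝 ((taylor z B).coeff k))) ∧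
      (∀ k, Tendsto (fun t => (taylor z ((a t).map (starRingEnd ℂ))).coeff k) u
        (𝓝 ((taylor z (A.map (starRingEnd ℂ))).coeff k))) ∧
      (∀ k, Tendsto (fun t => (taylor z ((b t).map (starRingEnd ℂ))).coeff k) u
        (𝓝 ((taylor z (B.map (starRingEnd ℂ))).coeff k))) := by
  obtain ⟨A, hA, hA'⟩ := exists_tendsto_of_bounded u (n := N + 1) (P := a)
    (fun t => by rw [(h t).degree_eq]; exact_mod_cast Nat.lt_succ_self N)
    (fun x => ⟨_, fun t => (h t).norm_eval_left_le hz x⟩)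
  obtain ⟨B, hB, hB'⟩ := exists_tendsto_of_bounded u (n := N) (P := b) (fun t => (h t).degree_lt)
    (fun x => ⟨_, fun t => (h t).norm_eval_right_le hz x⟩)
  have hcoeff : A.coeff N = 1 := by
    have h1 := hA' (lcoeff ℂ N)
    have h2 : ∀ t, lcoeff ℂ N (a t) = 1 := by
      intro t
      have := (h t).monic.coeff_natDegree
      rwa [(h t).natDegree_eq] at this
    simp only [h2] at h1
    exact tendsto_nhds_unique h1 tendsto_const_nhds |>.symm ▸ rfl
  have hAle : A.natDegree ≤ N := by
    have hA0 : A ≠ 0 := fun h0 => by simp [h0] at hcoeff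
    exact Nat.lt_succ_iff.mp ((natDegree_lt_iff_degree_lt hA0).mpr hA)
  have hAm : A.Monic := monic_of_natDegree_le_of_coeff_eq_one N hAle hcoeff
  have hstar : ∀ (p : ι → ℂ[X]) (Q : ℂ[X]),
      (∀ φ : ℂ[X] →ₗ[ℂ] ℂ, Tendsto (fun t => φ (p t)) u (𝓝 (φ Q))) →
      ∀ k, Tendsto (fun t => (taylor z ((p t).map (starRingEnd ℂ))).coeff k) u
        (𝓝 ((taylor z (Q.map (starRingEnd ℂ))).coeff k)) := by
    intro p Q hp k
    simp only [taylor_map_conj, coeff_map]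
    exact (Complex.continuous_conj.tendsto _).comp
      (hp ((lcoeff ℂ k).comp (taylor ((starRingEnd ℂ) z))))
  refine ⟨A, B, hAm, le_antisymm hAle (le_natDegree_of_ne_zero (by simp [hcoeff])), hB,
    fun k => hB' (lcoeff ℂ k), fun k => hA' ((lcoeff ℂ k).comp (taylor z)),
    fun k => hB' ((lcoeff ℂ k).comp (taylor z)), hstar _ _ hA', hstar _ _ hB'⟩

/-! ### Limits of Darboux pairs -/

/-- `f` behaves like `ρ exp (τ w)` modulo `w ^ N`. -/
def ExpLike {ι : Type*} (l : Filter ι) (N : ℕ) (f : ι → PowerSeries ℂ) (ρ τ : ι → ℂ) : Prop :=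
  ∀ k < N, Tendsto (fun t => PowerSeries.coeff k (f t) / (ρ t * τ t ^ k)) l
    (𝓝 ((k.factorial : ℂ)⁻¹))

theorem ExpLike.mono {ι : Type*} {l l' : Filter ι} {N : ℕ} {f : ι → PowerSeries ℂ} {ρ τ : ι → ℂ}
    (h : ExpLike l N f ρ τ) (hl : l' ≤ l) : ExpLike l' N f ρ τ :=
  fun k hk => (h k hk).mono_left hl

/-- The form of `tendsto_of_toeplitz` for sequences `P`, `Q` that converge. -/
theorem ExpLike.tendsto {ι : Type*} {u : Filter ι} {N s : ℕ} (hs : 1 ≤ s) (hsN : s ≤ N)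
    {f : ι → PowerSeries ℂ} {ρ τ : ι → ℂ} (hf : ExpLike u N f ρ τ) (hρ : ∀ᶠ t in u, ρ t ≠ 0)
    (hτ : Tendsto (fun t => ‖τ t‖) u atTop)
    {P Q : ι → ℕ → ℂ} {P' Q' : ℕ → ℂ}
    (hPQ : ∀ t, ∀ k < N, Q t k =
      ∑ p ∈ antidiagonal k, P t p.1 * PowerSeries.coeff p.2 (f t))
    (hP : ∀ k, Tendsto (fun t => P t k) u (𝓝 (P' k)))
    (hQ : ∀ k, Tendsto (fun t => Q t k) u (𝓝 (Q' k))) {η : ℂ}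
    (hη : Tendsto (fun t => (ρ t)⁻¹ * τ t ^ (2 * (s : ℤ) - 1 - N)) u (𝓝 η)) [u.NeBot] :
    (∀ j < s - 1, P' j = 0) ∧
      P' (s - 1) = (expMatrix (N - s) s)⁻¹ ⟨s - 1, by omega⟩ ⟨0, by omega⟩ * (η * Q' (N - s)) := by
  have hτ0 : ∀ᶠ t in u, τ t ≠ 0 := by
    filter_upwards [hτ.eventually_gt_atTop 0] with t ht
    exact norm_pos_iff.mp ht
  have h := tendsto_of_toeplitz (u := u) (P := P) (Q := Q) hs hsN hρ hτ hf (by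
      filter_upwards [hρ, hτ0] with t h1 h2
      intro k hk
      rw [hPQ t k hk]
      refine Finset.sum_congr rfl fun p _ => ?_
      congr 1
      field_simp)
    (fun k _ => (hP k).norm.isBoundedUnder_le) (fun k _ => (hQ k).norm.isBoundedUnder_le) hη
    ((hQ _).const_mul η)
  exact ⟨fun j hj => tendsto_nhds_unique (hP j) (h.1 j hj), tendsto_nhds_unique (hP _) h.2⟩

/-- A polynomial with more than its degree of zeros at `z` and `z̄` vanishes. -/
theorem eq_zero_of_dvd {N m n : ℕ} {z : ℂ} (hz : z.im ≠ 0) {B : ℂ[X]}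
    (hB : B.degree < (N : WithBot ℕ)) (h1 : (X - C z) ^ m ∣ B)
    (h2 : (X - C z) ^ n ∣ B.map (starRingEnd ℂ)) (hmn : N ≤ m + n) : B = 0 := by
  rw [X_sub_C_pow_dvd_map_conj_iff] at h2
  have h3 := (isCoprime_X_sub_C_pow hz m n).mul_dvd h1 h2
  by_contra h0
  have h4 := natDegree_le_of_dvd h3 h0
  rw [natDegree_mul (pow_ne_zero _ (X_sub_C_ne_zero _)) (pow_ne_zero _ (X_sub_C_ne_zero _)),
    natDegree_pow, natDegree_pow, natDegree_X_sub_C, natDegree_X_sub_C] at h4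
  have := (natDegree_lt_iff_degree_lt h0).mpr hB
  omega

section Limits

variable {ι : Type*} {N : ℕ} {z : ℂ} {f fi : ι → PowerSeries ℂ} {a b : ι → ℂ[X]}

theorem tendsto_zero_of_coeff_tendsto_zero (u : Ultrafilter ι) (hz : z.im ≠ 0)
    (h : ∀ t, IsDarbouxPair N z (f t) (a t) (b t))
    (hf : ∀ k < N, Tendsto (fun t => PowerSeries.coeff k (f t)) u (𝓝 0)) (n : ℕ) :
    Tendsto (fun t => (b t).coeff n) u (𝓝 0) := by
  obtain ⟨A, B, hA, hAN, hB, hb, ha1, hb1, ha2, hb2⟩ := exists_limit_pair u hz h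
  have h1 : (X - C z) ^ N ∣ B.map (starRingEnd ℂ) := by
    rw [X_sub_C_pow_dvd_iff]
    intro k hk
    refine tendsto_nhds_unique (hb2 k) ?_
    simp only [fun t => (h t).coeff_conj_right k hk]
    rw [show (0 : ℂ) = ∑ p ∈ antidiagonal k,
      (taylor z (A.map (starRingEnd ℂ))).coeff p.1 * 0 by simp]
    refine tendsto_finsetSum _ fun p hp => (ha2 _).mul (hf _ ?_)
    have := Finset.HasAntidiagonal.mem_antidiagonal.mp hp
    omega
  have h0 : B = 0 := eq_zero_of_dvd hz (m := 0) hB (by simp) h1 (by simp)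
  simpa [h0] using hb n

theorem tendsto_zero_of_coeff_inv_tendsto_zero (u : Ultrafilter ι) (hz : z.im ≠ 0)
    (h : ∀ t, IsDarbouxPair N z (f t) (a t) (b t)) (hinv : ∀ t, f t * fi t = 1)
    (hf : ∀ k < N, Tendsto (fun t => PowerSeries.coeff k (fi t)) u (𝓝 0)) (n : ℕ) :
    Tendsto (fun t => (b t).coeff n) u (𝓝 0) := by
  obtain ⟨A, B, hA, hAN, hB, hb, ha1, hb1, ha2, hb2⟩ := exists_limit_pair u hz h
  have h1 : (X - C z) ^ N ∣ B := by
    rw [X_sub_C_pow_dvd_iff]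
    intro k hk
    refine neg_eq_zero.mp (tendsto_nhds_unique (hb1 k).neg ?_)
    simp only [fun t => (h t).neg_coeff_right (hinv t) k hk]
    rw [show (0 : ℂ) = ∑ p ∈ antidiagonal k, (taylor z A).coeff p.1 * 0 by simp]
    refine tendsto_finsetSum _ fun p hp => (ha1 _).mul (hf _ ?_)
    have := Finset.HasAntidiagonal.mem_antidiagonal.mp hp
    omega
  have h0 : B = 0 := eq_zero_of_dvd hz (n := 0) hB h1 (by simp) (by simp)
  simpa [h0] using hb n

/-- Between two characteristic curves the limit of `b` has a zero of order `m` at `z` and one of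
order `N - m` at `z̄`. For `m = 0` and `m = N` one of the two conditions is void. -/
theorem tendsto_zero_of_gap (u : Ultrafilter ι) (hz : z.im ≠ 0)
    (h : ∀ t, IsDarbouxPair N z (f t) (a t) (b t)) (hinv : ∀ t, f t * fi t = 1)
    {ρ τ : ι → ℂ} (hρ : ∀ᶠ t in u, ρ t ≠ 0) (hτ : Tendsto (fun t => ‖τ t‖) u atTop)
    (hf : ExpLike u N f ρ τ) (hfi : ExpLike u N fi (fun t => (ρ t)⁻¹) (fun t => -τ t))
    {m : ℕ} (hm : m ≤ N)
    (h1 : 1 ≤ m → Tendsto (fun t => (ρ t)⁻¹ * τ t ^ (2 * (m : ℤ) - 1 - N)) u (𝓝 0))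
    (h2 : m < N → Tendsto (fun t => ρ t * τ t ^ ((N : ℤ) - 1 - 2 * m)) u (𝓝 0)) (n : ℕ) :
    Tendsto (fun t => (b t).coeff n) u (𝓝 0) := by
  obtain ⟨A, B, hA, hAN, hB, hb, ha1, hb1, ha2, hb2⟩ := exists_limit_pair u hz h
  have hd1 : (X - C z) ^ m ∣ B := by
    rw [X_sub_C_pow_dvd_iff]
    intro k hk
    have := hf.tendsto (s := m) (by omega) hm hρ hτ
      (P := fun t k => (taylor z (b t)).coeff k) (Q := fun t k => -(taylor z (a t)).coeff k)
      (fun t k hk => (h t).neg_coeff_left k hk) hb1 (fun k => (ha1 k).neg) (h1 (by omega))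
    rcases (Nat.le_sub_one_of_lt hk).lt_or_eq with hk' | hk'
    · exact this.1 k hk'
    · rw [hk', this.2]; simp
  have hd2 : (X - C z) ^ (N - m) ∣ B.map (starRingEnd ℂ) := by
    rw [X_sub_C_pow_dvd_iff]
    intro k hk
    have hη : Tendsto (fun t => ((ρ t)⁻¹)⁻¹ * (-τ t) ^ (2 * ((N - m : ℕ) : ℤ) - 1 - N)) u
        (𝓝 0) := by
      have h3 := (h2 (by omega)).const_mul ((-1 : ℂ) ^ ((N : ℤ) - 1 - 2 * m))
      rw [mul_zero] at h3
      refine h3.congr fun t => ?_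
      rw [inv_inv, Nat.cast_sub hm, show 2 * ((N : ℤ) - m) - 1 - N = (N : ℤ) - 1 - 2 * m by ring,
        neg_eq_neg_one_mul (τ t), mul_zpow]
      ring
    have := hfi.tendsto (s := N - m) (by omega) (by omega)
      (hρ.mono fun t ht => inv_ne_zero ht) (by simpa using hτ)
      (P := fun t k => (taylor z ((b t).map (starRingEnd ℂ))).coeff k)
      (Q := fun t k => (taylor z ((a t).map (starRingEnd ℂ))).coeff k)
      (fun t k hk => (h t).coeff_conj_left (hinv t) k hk) hb2 ha2 hη
    rcases (Nat.le_sub_one_of_lt hk).lt_or_eq with hk' | hk'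
    · exact this.1 k hk'
    · rw [hk', this.2]; simp
  have h0 : B = 0 := eq_zero_of_dvd hz hB hd1 hd2 (by omega)
  simpa [h0] using hb n

/-- The divisibility conditions say that `A = (λ - z)^(N-1-m) (λ - z̄)^m (λ - c)` and
`B = β (λ - z)^m (λ - z̄)^(N-1-m)`. The conclusion is what remains of the two relations between
coefficients of `A` and `B` after elimination of `c`. -/
theorem balanced_limit (hz : z.im ≠ 0) {A B : ℂ[X]} {m : ℕ} (hm : m < N) (hA : A.Monic)
    (hAN : A.natDegree = N) (hB : B.degree < (N : WithBot ℕ))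
    (hA1 : (X - C z) ^ (N - 1 - m) ∣ A) (hA2 : (X - C z) ^ m ∣ A.map (starRingEnd ℂ))
    (hB1 : (X - C z) ^ m ∣ B) (hB2 : (X - C z) ^ (N - 1 - m) ∣ B.map (starRingEnd ℂ))
    {r r' : ℂ} (h1 : (taylor z A).coeff (N - 1 - m) = r * (taylor z B).coeff m)
    (h2 : (taylor z (A.map (starRingEnd ℂ))).coeff m =
      r' * (taylor z (B.map (starRingEnd ℂ))).coeff (N - 1 - m)) :
    (r * (z - (starRingEnd ℂ) z) ^ (N - 1 - m) / (z - (starRingEnd ℂ) z) ^ m -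
      (starRingEnd ℂ) (r' * (z - (starRingEnd ℂ) z) ^ m / (z - (starRingEnd ℂ) z) ^ (N - 1 - m))) *
      B.coeff (N - 1) = z - (starRingEnd ℂ) z := by
  set z' := (starRingEnd ℂ) z with hz'
  have hD : z - z' ≠ 0 := by
    intro h0
    apply hz
    have := congrArg Complex.im h0
    simp [hz'] at this
    linarith
  obtain ⟨c, hAc⟩ : ∃ c, A = (X - C z) ^ (N - 1 - m) * (X - C z') ^ m * (X - C c) := by
    rw [X_sub_C_pow_dvd_map_conj_iff] at hA2
    obtain ⟨R, hR⟩ := (isCoprime_X_sub_C_pow hz (N - 1 - m) m).mul_dvd hA1 hA2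
    have hq : ((X - C z) ^ (N - 1 - m) * (X - C z') ^ m : ℂ[X]).Monic :=
      ((monic_X_sub_C z).pow _).mul ((monic_X_sub_C _).pow _)
    have hRm : R.Monic := by
      refine hq.of_mul_monic_left ?_
      rw [← hR]; exact hA
    have hRd : R.natDegree = 1 := by
      have h3 := congrArg natDegree hR
      rw [hq.natDegree_mul hRm, hAN, natDegree_mul (pow_ne_zero _ (X_sub_C_ne_zero _))
        (pow_ne_zero _ (X_sub_C_ne_zero _)), natDegree_pow, natDegree_pow, natDegree_X_sub_C,
        natDegree_X_sub_C] at h3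
      omega
    refine ⟨-R.coeff 0, ?_⟩
    rw [hR]
    congr 1
    rw [hRm.eq_X_add_C hRd]
    simp
  obtain ⟨β, hBβ⟩ : ∃ β, B = (X - C z) ^ m * (X - C z') ^ (N - 1 - m) * C β := by
    rw [X_sub_C_pow_dvd_map_conj_iff] at hB2
    obtain ⟨R, hR⟩ := (isCoprime_X_sub_C_pow hz m (N - 1 - m)).mul_dvd hB1 hB2
    have hq : ((X - C z) ^ m * (X - C z') ^ (N - 1 - m) : ℂ[X]).Monic :=
      ((monic_X_sub_C z).pow _).mul ((monic_X_sub_C _).pow _)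
    have hRd : R.natDegree = 0 := by
      by_cases hR0 : R = 0
      · simp [hR0]
      have hB0 : B ≠ 0 := by
        rw [hR]; exact mul_ne_zero hq.ne_zero hR0
      have h3 := congrArg natDegree hR
      rw [hq.natDegree_mul' hR0, natDegree_mul (pow_ne_zero _ (X_sub_C_ne_zero _))
        (pow_ne_zero _ (X_sub_C_ne_zero _)), natDegree_pow, natDegree_pow, natDegree_X_sub_C,
        natDegree_X_sub_C] at h3
      have := (natDegree_lt_iff_degree_lt hB0).mpr hB
      omega
    refine ⟨R.coeff 0, ?_⟩
    rw [hR]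
    congr 1
    exact eq_C_of_natDegree_eq_zero hRd
  have hβ : B.coeff (N - 1) = β := by
    have hq : ((X - C z) ^ m * (X - C z') ^ (N - 1 - m) : ℂ[X]).Monic :=
      ((monic_X_sub_C z).pow _).mul ((monic_X_sub_C _).pow _)
    have h3 := hq.coeff_natDegree
    rw [natDegree_mul (pow_ne_zero _ (X_sub_C_ne_zero _))
        (pow_ne_zero _ (X_sub_C_ne_zero _)), natDegree_pow, natDegree_pow, natDegree_X_sub_C,
        natDegree_X_sub_C, show m * 1 + (N - 1 - m) * 1 = N - 1 by omega] at h3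
    rw [hBβ, coeff_mul_C, h3, one_mul]
  rw [hβ]
  have hAs : A.map (starRingEnd ℂ) =
      (X - C z) ^ m * ((X - C z') ^ (N - 1 - m) * (X - C ((starRingEnd ℂ) c))) := by
    rw [hAc]
    simp only [Polynomial.map_mul, Polynomial.map_pow, Polynomial.map_sub, map_X, map_C, hz',
      Complex.conj_conj]
    ring
  have hBs : B.map (starRingEnd ℂ) =
      (X - C z) ^ (N - 1 - m) * ((X - C z') ^ m * C ((starRingEnd ℂ) β)) := by
    rw [hBβ]
    simp only [Polynomial.map_mul, Polynomial.map_pow, Polynomial.map_sub, map_X, map_C, hz',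
      Complex.conj_conj]
    ring
  rw [hAs, hBs, coeff_taylor_X_sub_C_pow_mul, coeff_taylor_X_sub_C_pow_mul] at h2
  rw [hAc, hBβ, mul_assoc, mul_assoc, coeff_taylor_X_sub_C_pow_mul,
    coeff_taylor_X_sub_C_pow_mul] at h1
  simp only [eval_mul, eval_pow, eval_sub, eval_X, eval_C] at h1 h2
  have h3 : z - c = r * (z - z') ^ (N - 1 - m) / (z - z') ^ m * β := by
    field_simp
    linear_combination h1
  have h4 : z - (starRingEnd ℂ) c =
      r' * (z - z') ^ m / (z - z') ^ (N - 1 - m) * (starRingEnd ℂ) β := by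
    field_simp
    linear_combination h2
  have h5 := congrArg (starRingEnd ℂ) h4
  rw [map_sub, Complex.conj_conj, map_mul, Complex.conj_conj, ← hz'] at h5
  linear_combination h5 - h3

/-- All limits of `b_{N-1}` along ultrafilters solve one linear equation `κ β = z - z̄`. Since at
least one such limit exists, `κ ≠ 0`, so that the limit is unique and non-zero. -/
theorem tendsto_of_balance {l : Filter ι} [l.NeBot] (hz : z.im ≠ 0)
    (h : ∀ t, IsDarbouxPair N z (f t) (a t) (b t)) (hinv : ∀ t, f t * fi t = 1)
    {ρ τ : ι → ℂ} (hρ : ∀ᶠ t in l, ρ t ≠ 0) (hτ : Tendsto (fun t => ‖τ t‖) l atTop)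
    (hf : ExpLike l N f ρ τ) (hfi : ExpLike l N fi (fun t => (ρ t)⁻¹) (fun t => -τ t))
    {m : ℕ} (hm : m < N) {ω : ℂ} (hω0 : ω ≠ 0)
    (hω : Tendsto (fun t => ρ t * τ t ^ ((N : ℤ) - 1 - 2 * m)) l (𝓝 ω)) :
    ∃ β : ℂ, β ≠ 0 ∧ Tendsto (fun t => (b t).coeff (N - 1)) l (𝓝 β) := by
  set r : ℂ := -((expMatrix (N - (N - m)) (N - m))⁻¹ ⟨N - m - 1, by omega⟩ ⟨0, by omega⟩ *
    ((-1 : ℂ) ^ ((N : ℤ) - 1 - 2 * m) * ω)) with hr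
  set r' : ℂ := (expMatrix (N - (m + 1)) (m + 1))⁻¹ ⟨m + 1 - 1, by omega⟩ ⟨0, by omega⟩ * ω⁻¹
    with hr'
  set κ : ℂ := r * (z - (starRingEnd ℂ) z) ^ (N - 1 - m) / (z - (starRingEnd ℂ) z) ^ m -
      (starRingEnd ℂ) (r' * (z - (starRingEnd ℂ) z) ^ m / (z - (starRingEnd ℂ) z) ^ (N - 1 - m))
    with hκ
  have hD : z - (starRingEnd ℂ) z ≠ 0 := by
    intro h0
    apply hz
    have := congrArg Complex.im h0
    simp at this
    linarith
  have hτ0 : ∀ᶠ t in l, τ t ≠ 0 := by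
    filter_upwards [hτ.eventually_gt_atTop 0] with t ht
    exact norm_pos_iff.mp ht
  have key : ∀ u : Ultrafilter ι, ↑u ≤ l → ∃ β, κ * β = z - (starRingEnd ℂ) z ∧
      Tendsto (fun t => (b t).coeff (N - 1)) u (𝓝 β) := by
    intro u hu
    obtain ⟨A, B, hA, hAN, hB, hb, ha1, hb1, ha2, hb2⟩ := exists_limit_pair u hz h
    have hη1 : Tendsto (fun t => (ρ t)⁻¹ * τ t ^ (2 * ((m + 1 : ℕ) : ℤ) - 1 - N)) u (𝓝 ω⁻¹) := by
      refine ((hω.inv₀ hω0).congr' ?_).mono_left hu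
      filter_upwards [hτ0] with t ht
      rw [mul_inv, ← zpow_neg]
      congr 2
      push_cast
      ring
    have hη2 : Tendsto (fun t => ((ρ t)⁻¹)⁻¹ * (-τ t) ^ (2 * ((N - m : ℕ) : ℤ) - 1 - N)) u
        (𝓝 ((-1 : ℂ) ^ ((N : ℤ) - 1 - 2 * m) * ω)) := by
      refine ((hω.const_mul ((-1 : ℂ) ^ ((N : ℤ) - 1 - 2 * m))).congr fun t => ?_).mono_left hu
      rw [inv_inv, Nat.cast_sub hm.le, show 2 * ((N : ℤ) - m) - 1 - N = (N : ℤ) - 1 - 2 * m by ring,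
        neg_eq_neg_one_mul (τ t), mul_zpow]
      ring
    have hρu := hρ.filter_mono hu
    have hρu' : ∀ᶠ t in u, (ρ t)⁻¹ ≠ 0 := hρu.mono fun t ht => inv_ne_zero ht
    have hτu := hτ.mono_left hu
    have hτu' : Tendsto (fun t => ‖-τ t‖) u atTop := by simpa using hτu
    have e1 := (hf.mono hu).tendsto (s := m + 1) (by omega) hm hρu hτu
      (P := fun t k => (taylor z (b t)).coeff k) (Q := fun t k => -(taylor z (a t)).coeff k)
      (fun t k hk => (h t).neg_coeff_left k hk) hb1 (fun k => (ha1 k).neg) hη1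
    have e2 := (hfi.mono hu).tendsto (s := N - m) (by omega) (by omega) hρu' hτu'
      (P := fun t k => (taylor z (a t)).coeff k) (Q := fun t k => -(taylor z (b t)).coeff k)
      (fun t k hk => (h t).neg_coeff_right (hinv t) k hk) ha1 (fun k => (hb1 k).neg) hη2
    have e3 := (hf.mono hu).tendsto (s := m + 1) (by omega) hm hρu hτu
      (P := fun t k => (taylor z ((a t).map (starRingEnd ℂ))).coeff k)
      (Q := fun t k => (taylor z ((b t).map (starRingEnd ℂ))).coeff k)
      (fun t k hk => (h t).coeff_conj_right k hk) ha2 hb2 hη1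
    have e4 := (hfi.mono hu).tendsto (s := N - m) (by omega) (by omega) hρu' hτu'
      (P := fun t k => (taylor z ((b t).map (starRingEnd ℂ))).coeff k)
      (Q := fun t k => (taylor z ((a t).map (starRingEnd ℂ))).coeff k)
      (fun t k hk => (h t).coeff_conj_left (hinv t) k hk) hb2 ha2 hη2
    refine ⟨_, ?_, hb (N - 1)⟩
    refine balanced_limit hz hm hA hAN hB ?_ ?_ ?_ ?_ ?_ ?_
    · exact (X_sub_C_pow_dvd_iff _ _ _).mpr fun k hk => e2.1 k (by omega)
    · exact (X_sub_C_pow_dvd_iff _ _ _).mpr fun k hk => e3.1 k (by omega)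
    · exact (X_sub_C_pow_dvd_iff _ _ _).mpr fun k hk => e1.1 k (by omega)
    · exact (X_sub_C_pow_dvd_iff _ _ _).mpr fun k hk => e4.1 k (by omega)
    · have h3 : (taylor z A).coeff (N - 1 - m) = (taylor z A).coeff (N - m - 1) :=
        congrArg _ (by omega)
      have h4 : (taylor z B).coeff (N - (N - m)) = (taylor z B).coeff m := congrArg _ (by omega)
      rw [h3, e2.2, h4, hr]
      ring
    · have h4 : (taylor z (B.map (starRingEnd ℂ))).coeff (N - (m + 1)) =
          (taylor z (B.map (starRingEnd ℂ))).coeff (N - 1 - m) := congrArg _ (by omega)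
      rw [h4] at e3
      refine e3.2.trans ?_
      rw [hr']
      ring
  obtain ⟨β₀, hβ₀, _⟩ := key (Ultrafilter.of l) (Ultrafilter.of_le l)
  have hκ0 : κ ≠ 0 := by
    rintro h0
    rw [h0, zero_mul] at hβ₀
    exact hD hβ₀.symm
  refine ⟨(z - (starRingEnd ℂ) z) / κ, div_ne_zero hD hκ0, ?_⟩
  rw [tendsto_iff_ultrafilter]
  intro u hu
  obtain ⟨β, hβ, hlim⟩ := key u hu
  rwa [← hβ, mul_div_cancel_left₀ _ hκ0]

end Limits

/-! ### Taylor series of exponentials of polynomials -/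

/-- The Taylor series of `F` at `z`. -/
noncomputable def taylorSeries (z : ℂ) (F : ℂ → ℂ) : PowerSeries ℂ :=
  PowerSeries.mk fun k => (k.factorial : ℂ)⁻¹ * iteratedDeriv k F z

theorem coeff_zero_taylorSeries (z : ℂ) (F : ℂ → ℂ) :
    PowerSeries.coeff 0 (taylorSeries z F) = F z := by
  simp [taylorSeries]

theorem derivative_taylorSeries (z : ℂ) (F : ℂ → ℂ) :
    PowerSeries.derivative ℂ (taylorSeries z F) = taylorSeries z (deriv F) := by
  ext k
  rw [PowerSeries.coeff_derivative]
  simp only [taylorSeries, PowerSeries.coeff_mk, iteratedDeriv_succ', Nat.factorial_succ]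
  have : (k.factorial : ℂ) ≠ 0 := by exact_mod_cast k.factorial_ne_zero
  have : (k : ℂ) + 1 ≠ 0 := by exact_mod_cast k.succ_ne_zero
  push_cast
  field_simp

theorem taylorSeries_mul (z : ℂ) {F G : ℂ → ℂ} (hF : Differentiable ℂ F)
    (hG : Differentiable ℂ G) : taylorSeries z (F * G) = taylorSeries z F * taylorSeries z G := by
  ext k
  rw [PowerSeries.coeff_mul, Finset.Nat.sum_antidiagonal_eq_sum_range_succ_mk]
  simp only [taylorSeries, PowerSeries.coeff_mk]
  rw [iteratedDeriv_mul hF.contDiff.contDiffAt hG.contDiff.contDiffAt, Finset.mul_sum]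
  refine Finset.sum_congr rfl fun i hi => ?_
  have hik : i ≤ k := by simpa [Nat.lt_succ_iff] using hi
  rw [Nat.cast_choose ℂ hik]
  have : (k.factorial : ℂ) ≠ 0 := by exact_mod_cast k.factorial_ne_zero
  field_simp

theorem taylorSeries_polynomial (z : ℂ) (p : ℂ[X]) :
    taylorSeries z (fun w => p.eval (w - z)) = p := by
  induction hn : p.natDegree using Nat.strong_induction_on generalizing p with
  | _ n ih =>
    refine PowerSeries.derivative.ext ?_ ?_
    · have h1 : deriv (fun w => p.eval (w - z)) = fun w => (derivative p).eval (w - z) := by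
        ext w
        exact ((p.hasDerivAt (w - z)).comp_sub_const w z).deriv
      rw [derivative_taylorSeries, h1, PowerSeries.derivative_coe]
      rcases Nat.eq_zero_or_pos n with h0 | h0
      · have h2 : derivative p = 0 := derivative_of_natDegree_zero (hn.trans h0)
        rw [h2]
        ext k
        simp [taylorSeries]
      · exact ih _ (by rw [← hn]; exact natDegree_derivative_lt (by omega)) _ rfl
    · rw [← PowerSeries.coeff_zero_eq_constantCoeff_apply, coeff_zero_taylorSeries,
        ← PowerSeries.coeff_zero_eq_constantCoeff_apply]
      simp [coeff_zero_eq_eval_zero]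

theorem derivative_taylorSeries_exp (z : ℂ) (p : ℂ[X]) :
    PowerSeries.derivative ℂ (taylorSeries z fun w => Complex.exp (p.eval (w - z))) =
      PowerSeries.derivative ℂ (p : PowerSeries ℂ) *
        taylorSeries z fun w => Complex.exp (p.eval (w - z)) := by
  have hp : ∀ w, HasDerivAt (fun w => p.eval (w - z)) ((derivative p).eval (w - z)) w :=
    fun w => (p.hasDerivAt (w - z)).comp_sub_const w z
  have h1 : deriv (fun w => Complex.exp (p.eval (w - z))) =
      (fun w => (derivative p).eval (w - z)) * fun w => Complex.exp (p.eval (w - z)) := by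
    ext w
    rw [(hp w).cexp.deriv, Pi.mul_apply, mul_comm]
  have hd : ∀ q : ℂ[X], Differentiable ℂ fun w => q.eval (w - z) := fun q =>
    q.differentiable.comp (differentiable_id.sub_const z)
  rw [derivative_taylorSeries, h1, taylorSeries_mul z (hd _) (hd p).cexp, taylorSeries_polynomial,
    PowerSeries.derivative_coe]

theorem taylorSeries_exp_mul_neg (z : ℂ) (p : ℂ[X]) :
    (taylorSeries z fun w => Complex.exp (p.eval (w - z))) *
      (taylorSeries z fun w => Complex.exp ((-p).eval (w - z))) = 1 := by
  have hd : ∀ q : ℂ[X], Differentiable ℂ fun w => q.eval (w - z) := fun q =>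
    q.differentiable.comp (differentiable_id.sub_const z)
  rw [← taylorSeries_mul z (hd p).cexp (hd (-p)).cexp]
  have h1 : ((fun w => Complex.exp (p.eval (w - z))) * fun w => Complex.exp ((-p).eval (w - z))) =
      fun w => (1 : ℂ[X]).eval (w - z) := by
    ext w
    simp [← Complex.exp_add]
  rw [h1, taylorSeries_polynomial, coe_one]

theorem coeff_succ_of_derivative_eq {f h : PowerSeries ℂ}
    (hf : PowerSeries.derivative ℂ f = PowerSeries.derivative ℂ h * f) (k : ℕ) :
    PowerSeries.coeff (k + 1) f = ((k : ℂ) + 1)⁻¹ * ∑ p ∈ antidiagonal k,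
      ((p.1 : ℂ) + 1) * PowerSeries.coeff (p.1 + 1) h * PowerSeries.coeff p.2 f := by
  have h1 := congrArg (PowerSeries.coeff k) hf
  rw [PowerSeries.coeff_derivative, PowerSeries.coeff_mul] at h1
  have : (k : ℂ) + 1 ≠ 0 := by exact_mod_cast k.succ_ne_zero
  rw [eq_inv_mul_iff_mul_eq₀ this, mul_comm, h1]
  refine Finset.sum_congr rfl fun p _ => ?_
  rw [PowerSeries.coeff_derivative]
  ring

/-- A solution of `f' = h' f` is exponential-like if the linear term of `h` dominates at the scale
`w ~ 1 / τ`: the recursion for the coefficients of `f` passes to the limit. -/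
theorem expLike_of_derivative_eq {ι : Type*} {l : Filter ι} {N : ℕ} {f h : ι → PowerSeries ℂ}
    {ρ τ : ι → ℂ} (hρ : ∀ t, ρ t ≠ 0) (hτ : ∀ᶠ t in l, τ t ≠ 0)
    (hf0 : ∀ t, PowerSeries.coeff 0 (f t) = ρ t)
    (hf : ∀ t, PowerSeries.derivative ℂ (f t) = PowerSeries.derivative ℂ (h t) * f t)
    (h1 : Tendsto (fun t => PowerSeries.coeff 1 (h t) / τ t) l (𝓝 1))
    (h2 : ∀ k, 2 ≤ k → Tendsto (fun t => PowerSeries.coeff k (h t) / τ t ^ k) l (𝓝 0)) :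
    ExpLike l N f ρ τ := by
  have key : ∀ k, Tendsto (fun t => PowerSeries.coeff k (f t) / (ρ t * τ t ^ k)) l
      (𝓝 ((k.factorial : ℂ)⁻¹)) := by
    intro k
    induction k using Nat.strong_induction_on with
    | _ k ih =>
      rcases k with _ | k
      · simp [hf0, hρ, tendsto_const_nhds]
      · have h3 : ∀ i : ℕ, Tendsto (fun t => PowerSeries.coeff (i + 1) (h t) / τ t ^ (i + 1)) l
            (𝓝 (if i = 0 then 1 else 0)) := by
          intro i
          split_ifs with hi
          · subst hi; simpa using h1
          · exact h2 _ (by omega)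
        have h4 : Tendsto (fun t => ((k : ℂ) + 1)⁻¹ * ∑ p ∈ antidiagonal k, ((p.1 : ℂ) + 1) *
            (PowerSeries.coeff (p.1 + 1) (h t) / τ t ^ (p.1 + 1)) *
              (PowerSeries.coeff p.2 (f t) / (ρ t * τ t ^ p.2))) l
            (𝓝 (((k : ℂ) + 1)⁻¹ * ∑ p ∈ antidiagonal k, ((p.1 : ℂ) + 1) *
              (if p.1 = 0 then 1 else 0) * ((p.2.factorial : ℂ)⁻¹))) := by
          refine (tendsto_finsetSum _ fun p hp => ?_).const_mul _
          have := Finset.HasAntidiagonal.mem_antidiagonal.mp hp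
          exact ((h3 p.1).const_mul _).mul (ih p.2 (by omega))
        have h5 : ((k : ℂ) + 1)⁻¹ * ∑ p ∈ antidiagonal k, ((p.1 : ℂ) + 1) *
              (if p.1 = 0 then 1 else 0) * ((p.2.factorial : ℂ)⁻¹) =
            (((k + 1).factorial : ℂ)⁻¹) := by
          rw [Finset.sum_eq_single (0, k)]
          · simp [Nat.factorial_succ, mul_comm]
          · rintro ⟨i, j⟩ hp hne
            have h6 := Finset.HasAntidiagonal.mem_antidiagonal.mp hp
            simp only at h6
            have h7 : i ≠ 0 := by
              rintro rfl
              exact hne (by simp at h6; simp [h6])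
            simp [h7]
          · intro hp
            exact absurd (Finset.HasAntidiagonal.mem_antidiagonal.mpr (by simp)) hp
        rw [← h5]
        refine h4.congr' ?_
        filter_upwards [hτ] with t ht
        rw [coeff_succ_of_derivative_eq (hf t) k, mul_div_assoc, Finset.sum_div]
        congr 1
        refine Finset.sum_congr rfl fun p hp => ?_
        have h6 := Finset.HasAntidiagonal.mem_antidiagonal.mp hp
        have h7 := hρ t
        rw [← h6]
        field_simp
        ring
  exact fun k _ => key k

open Asymptotics in
theorem isBigO_of_derivative_eq {ι : Type*} {l : Filter ι} {f h : ι → PowerSeries ℂ}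
    {ρ : ι → ℂ} {T : ι → ℝ} (hT : ∀ t, 1 ≤ T t)
    (hf0 : ∀ t, PowerSeries.coeff 0 (f t) = ρ t)
    (hf : ∀ t, PowerSeries.derivative ℂ (f t) = PowerSeries.derivative ℂ (h t) * f t)
    (hh : ∀ k, (fun t => PowerSeries.coeff (k + 1) (h t)) =O[l] T) (k : ℕ) :
    (fun t => PowerSeries.coeff k (f t)) =O[l] fun t => ‖ρ t‖ * T t ^ k := by
  induction k using Nat.strong_induction_on with
  | _ k ih =>
    rcases k with _ | k
    · simp only [hf0, pow_zero, mul_one]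
      exact (isBigO_refl _ _).norm_right
    · simp only [fun t => coeff_succ_of_derivative_eq (hf t) k]
      refine IsBigO.const_mul_left (IsBigO.fun_sum fun p hp => ?_) _
      have h6 := Finset.HasAntidiagonal.mem_antidiagonal.mp hp
      refine (((hh p.1).const_mul_left _).mul (ih p.2 (by omega))).trans ?_
      refine IsBigO.of_norm_le fun t => ?_
      have h0 : 0 ≤ T t := zero_le_one.trans (hT t)
      rw [Real.norm_eq_abs, abs_of_nonneg (by positivity)]
      calc T t * (‖ρ t‖ * T t ^ p.2) = ‖ρ t‖ * T t ^ (p.2 + 1) := by ring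
        _ ≤ ‖ρ t‖ * T t ^ (k + 1) := by
          refine mul_le_mul_of_nonneg_left (pow_le_pow_right₀ (hT t) (by omega)) (norm_nonneg _)

/-! ### Asymptotics of the phase -/

/-- The coefficient of `t` in `2 θ(λ₁ + w)`, when `x - v₁ t` is held fixed. -/
noncomputable def phasePolyTime (γ δ : ℝ) (z : ℂ) : ℂ[X] :=
  C (2 * Complex.I) * (C z + X) * (C (Hirota.velocity γ δ z : ℂ) + C (2 * (γ : ℂ)) * (C z + X) +
    C (4 * (δ : ℂ)) * (C z + X) ^ 2)

/-- The coefficient of `x - v₁ t` in `2 θ(λ₁ + w)`. -/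
noncomputable def phasePolySpace (z : ℂ) : ℂ[X] := C (2 * Complex.I) * (C z + X)

/-- The part of `2 θ(λ₁ + w)` that does not depend on `x` and `t`. -/
noncomputable def phasePolyConst {N : ℕ} (a : Fin N → ℂ) : ℂ[X] :=
  C 2 * ∑ j : Fin N, C (a j) * X ^ (j : ℕ) - C (Complex.I / 2 * (Real.pi : ℂ))

/-- The polynomial `w ↦ 2 θ(λ₁ + w)`. -/
noncomputable def phasePoly {N : ℕ} (γ δ : ℝ) (z : ℂ) (a : Fin N → ℂ) (x t : ℝ) : ℂ[X] :=
  C (t : ℂ) * phasePolyTime γ δ z + C ((x - Hirota.velocity γ δ z * t : ℝ) : ℂ) * phasePolySpace z +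
    phasePolyConst a

section

variable {N : ℕ} (γ δ : ℝ) (z : ℂ) (a : Fin N → ℂ) (x t : ℝ)

theorem two_mul_phase (w : ℂ) :
    2 * Hirota.phase γ δ z a x t w = (phasePoly γ δ z a x t).eval (w - z) := by
  simp only [Hirota.phase, phasePoly, phasePolyTime, phasePolySpace, phasePolyConst, eval_add,
    eval_sub, eval_mul, eval_C, eval_X, eval_pow, eval_finsetSum]
  push_cast
  ring

theorem phaseSeries_eq : phaseSeries γ δ z a x t =
    taylorSeries z fun w => Complex.exp ((phasePoly γ δ z a x t).eval (w - z)) := by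
  simp only [phaseSeries, taylorSeries, Hirota.phiCoeff, two_mul_phase]
  rfl

/-- The Taylor series of `exp (-2 θ)` at `λ₁`. -/
noncomputable def phaseSeriesInv : PowerSeries ℂ :=
  taylorSeries z fun w => Complex.exp ((-phasePoly γ δ z a x t).eval (w - z))

theorem phaseSeries_mul_inv : phaseSeries γ δ z a x t * phaseSeriesInv γ δ z a x t = 1 := by
  rw [phaseSeries_eq, phaseSeriesInv, taylorSeries_exp_mul_neg]

theorem coeff_phasePoly (k : ℕ) : (phasePoly γ δ z a x t).coeff k =
    t * (phasePolyTime γ δ z).coeff k +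
      ((x - Hirota.velocity γ δ z * t : ℝ) : ℂ) * (phasePolySpace z).coeff k +
        (phasePolyConst a).coeff k := by
  simp only [phasePoly, coeff_add, coeff_C_mul]

theorem phasePolyTime_coeff_one : (phasePolyTime γ δ z).coeff 1 =
    2 * Complex.I * (Hirota.velocity γ δ z + 4 * γ * z + 12 * δ * z ^ 2) := by
  have h1 : (phasePolyTime γ δ z).coeff 1 = (derivative (phasePolyTime γ δ z)).eval 0 := by
    rw [← coeff_zero_eq_eval_zero, coeff_derivative]; simp
  rw [h1, phasePolyTime]
  simp [derivative_pow]
  ring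

theorem phasePolyTime_coeff_one_ne_zero (hγδ : γ ≠ 0 ∨ δ ≠ 0) (hz : z.im ≠ 0) :
    (phasePolyTime γ δ z).coeff 1 ≠ 0 := by
  rw [phasePolyTime_coeff_one]
  refine mul_ne_zero (by simp) fun h0 => ?_
  have h1 := congrArg Complex.re h0
  have h2 := congrArg Complex.im h0
  simp [Hirota.velocity, pow_two] at h1 h2
  have h3 : δ * z.im ^ 2 = 0 := by nlinarith
  have hδ : δ = 0 := by simpa [hz] using h3
  have hγ : γ = 0 := by
    subst hδ
    simpa [hz] using h2
  simp [hγ, hδ] at hγδ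

/-- The velocity `v₁` is the one for which `Re θ₁` depends on `x` and `t` through `x - v₁ t`
alone. -/
theorem re_coeff_zero_phasePoly : ((phasePoly γ δ z a x t).coeff 0).re =
    ((phasePolyConst a).coeff 0).re - 2 * z.im * (x - Hirota.velocity γ δ z * t) := by
  have h1 : ((phasePolyTime γ δ z).coeff 0).re = 0 := by
    rw [coeff_zero_eq_eval_zero, phasePolyTime]
    simp [Hirota.velocity, pow_two]
    ring
  have h2 : ((phasePolySpace z).coeff 0).re = -2 * z.im := by
    rw [coeff_zero_eq_eval_zero, phasePolySpace]
    simp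
  rw [coeff_phasePoly, Complex.add_re, Complex.add_re, Complex.re_ofReal_mul,
    Complex.re_ofReal_mul, h1, h2]
  ring

end

section Near

variable {N : ℕ} {γ δ : ℝ} {z : ℂ} (a : Fin N → ℂ) {l : Filter ℝ} {x : ℝ → ℝ}

theorem phasePoly_coeff_div_tendsto (hγδ : γ ≠ 0 ∨ δ ≠ 0) (hz : z.im ≠ 0)
    (hl : Tendsto (fun t : ℝ => |t|) l atTop)
    (hx : Tendsto (fun t => (x t - Hirota.velocity γ δ z * t) / t) l (𝓝 0)) (k : ℕ) :
    Tendsto (fun t : ℝ => (phasePoly γ δ z a (x t) t).coeff k / ((phasePolyTime γ δ z).coeff 1 * t))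
      l (𝓝 ((phasePolyTime γ δ z).coeff k / (phasePolyTime γ δ z).coeff 1)) := by
  set c := (phasePolyTime γ δ z).coeff 1
  have hc : c ≠ 0 := phasePolyTime_coeff_one_ne_zero γ δ z hγδ hz
  have hinv : Tendsto (fun t : ℝ => (t : ℂ)⁻¹) l (𝓝 0) := by
    rw [tendsto_zero_iff_norm_tendsto_zero]
    refine hl.inv_tendsto_atTop.congr fun t => ?_
    simp
  have hx' : Tendsto (fun t => (((x t - Hirota.velocity γ δ z * t) / t : ℝ) : ℂ)) l (𝓝 0) := by
    exact (Complex.continuous_ofReal.tendsto' 0 0 Complex.ofReal_zero).comp hx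
  have h1 := (((hx'.mul_const ((phasePolySpace z).coeff k)).add
    (hinv.mul_const ((phasePolyConst a).coeff k))).const_add
    ((phasePolyTime γ δ z).coeff k)).div_const c
  simp only [zero_mul, add_zero] at h1
  refine h1.congr' ?_
  filter_upwards [hl.eventually_gt_atTop 0] with t ht
  have ht0 : (t : ℂ) ≠ 0 := by exact_mod_cast abs_pos.mp ht
  rw [coeff_phasePoly]
  push_cast
  field_simp
  ring

theorem expLike_phaseSeries (hγδ : γ ≠ 0 ∨ δ ≠ 0) (hz : z.im ≠ 0)
    (hl : Tendsto (fun t : ℝ => |t|) l atTop)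
    (hx : Tendsto (fun t => (x t - Hirota.velocity γ δ z * t) / t) l (𝓝 0)) :
    ExpLike l N (fun t => phaseSeries γ δ z a (x t) t)
        (fun t => Complex.exp ((phasePoly γ δ z a (x t) t).coeff 0))
        (fun t => (phasePolyTime γ δ z).coeff 1 * t) ∧
      ExpLike l N (fun t => phaseSeriesInv γ δ z a (x t) t)
        (fun t => (Complex.exp ((phasePoly γ δ z a (x t) t).coeff 0))⁻¹)
        (fun t => -((phasePolyTime γ δ z).coeff 1 * t)) := by
  set c := (phasePolyTime γ δ z).coeff 1 with hcdef
  have hc : c ≠ 0 := phasePolyTime_coeff_one_ne_zero γ δ z hγδ hz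
  have hτ : ∀ᶠ t : ℝ in l, c * (t : ℂ) ≠ 0 := by
    filter_upwards [hl.eventually_gt_atTop 0] with t ht
    have ht0 : (t : ℂ) ≠ 0 := by exact_mod_cast abs_pos.mp ht
    exact mul_ne_zero hc ht0
  have hτinv : Tendsto (fun t : ℝ => (c * (t : ℂ))⁻¹) l (𝓝 0) := by
    rw [tendsto_zero_iff_norm_tendsto_zero]
    have := (hl.const_mul_atTop (norm_pos_iff.mpr hc)).inv_tendsto_atTop
    refine this.congr fun t => ?_
    simp
  have h1 : Tendsto (fun t : ℝ => (phasePoly γ δ z a (x t) t).coeff 1 / (c * t)) l (𝓝 1) := by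
    have := phasePoly_coeff_div_tendsto a hγδ hz hl hx 1
    rwa [div_self hc] at this
  have h2 : ∀ k, 2 ≤ k →
      Tendsto (fun t : ℝ => (phasePoly γ δ z a (x t) t).coeff k / (c * t) ^ k) l (𝓝 0) := by
    intro k hk
    have h3 := (phasePoly_coeff_div_tendsto a hγδ hz hl hx k).mul (hτinv.pow (k - 1))
    rw [zero_pow (by omega), mul_zero] at h3
    refine h3.congr fun t => ?_
    rw [inv_pow, ← div_eq_mul_inv, div_div]
    congr 1
    rw [← hcdef, ← pow_succ']
    congr 1
    omega
  constructor
  · refine expLike_of_derivative_eq (h := fun t => (phasePoly γ δ z a (x t) t : PowerSeries ℂ))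
      (fun t => Complex.exp_ne_zero _) hτ (fun t => ?_) (fun t => ?_) ?_ ?_
    · rw [phaseSeries_eq, coeff_zero_taylorSeries, sub_self, coeff_zero_eq_eval_zero]
    · rw [phaseSeries_eq, derivative_taylorSeries_exp]
    · simpa using h1
    · intro k hk
      simpa using h2 k hk
  · refine expLike_of_derivative_eq (h := fun t => ((-phasePoly γ δ z a (x t) t : ℂ[X]) :
      PowerSeries ℂ)) (fun t => inv_ne_zero (Complex.exp_ne_zero _))
      (hτ.mono fun t ht => neg_ne_zero.mpr ht) (fun t => ?_) (fun t => ?_) ?_ ?_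
    · rw [phaseSeriesInv, coeff_zero_taylorSeries, sub_self, ← coeff_zero_eq_eval_zero, coeff_neg,
        Complex.exp_neg]
    · rw [phaseSeriesInv, derivative_taylorSeries_exp]
    · simpa [neg_div_neg_eq] using h1
    · intro k hk
      have h3 := (h2 k hk).const_mul (-((-1 : ℂ) ^ k)⁻¹)
      rw [mul_zero] at h3
      refine h3.congr fun t => ?_
      rw [Polynomial.coeff_coe, coeff_neg, neg_pow (c * (t : ℂ)), div_eq_mul_inv, div_eq_mul_inv,
        mul_inv]
      ring

end Near

section Far

variable {N : ℕ} {γ δ : ℝ} {z : ℂ} (a : Fin N → ℂ) {l : Filter ℝ} {x : ℝ → ℝ}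

open Asymptotics in
theorem phasePoly_coeff_isBigO (k : ℕ) : (fun t : ℝ => (phasePoly γ δ z a (x t) t).coeff k) =O[l]
    fun t : ℝ => 1 + |t| + |x t - Hirota.velocity γ δ z * t| := by
  simp only [coeff_phasePoly]
  have h1 : (fun t : ℝ => (t : ℂ)) =O[l]
      fun t : ℝ => 1 + |t| + |x t - Hirota.velocity γ δ z * t| := by
    refine IsBigO.of_norm_le fun t => ?_
    simp only [Complex.norm_real, Real.norm_eq_abs]
    have := abs_nonneg (x t - Hirota.velocity γ δ z * t)
    linarith
  have h2 : (fun t : ℝ => ((x t - Hirota.velocity γ δ z * t : ℝ) : ℂ)) =O[l]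
      fun t : ℝ => 1 + |t| + |x t - Hirota.velocity γ δ z * t| := by
    refine IsBigO.of_norm_le fun t => ?_
    simp only [Complex.norm_real, Real.norm_eq_abs]
    have := abs_nonneg t
    linarith
  have h3 : (fun _ : ℝ => (phasePolyConst a).coeff k) =O[l]
      fun t : ℝ => 1 + |t| + |x t - Hirota.velocity γ δ z * t| := by
    refine IsBigO.of_bound ‖(phasePolyConst a).coeff k‖ (Eventually.of_forall fun t => ?_)
    have h4 := abs_nonneg t
    have h5 := abs_nonneg (x t - Hirota.velocity γ δ z * t)
    rw [Real.norm_eq_abs, abs_of_nonneg (by positivity)]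
    exact le_mul_of_one_le_right (norm_nonneg _) (by linarith)
  refine IsBigO.add (IsBigO.add ?_ ?_) h3
  · simpa only [mul_comm] using h1.const_mul_left ((phasePolyTime γ δ z).coeff k)
  · simpa only [mul_comm] using h2.const_mul_left ((phasePolySpace z).coeff k)

/-- Away from the main ray the exponential beats every power of `|t| + |y|`. -/
theorem tendsto_exp_mul_pow {y : ℝ → ℝ} {K b ε : ℝ} (hb : 0 < b) (hε : 0 < ε) (k : ℕ)
    (hl : Tendsto (fun t : ℝ => |t|) l atTop) (hy : ∀ᶠ t in l, ε * |t| ≤ y t) :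
    Tendsto (fun t : ℝ => Real.exp (K - b * y t) * (1 + |t| + |y t|) ^ k) l (𝓝 0) := by
  have hytop : Tendsto y l atTop :=
    tendsto_atTop_mono' l hy (hl.const_mul_atTop hε)
  have h1 : Tendsto (fun s : ℝ => Real.exp K * (2 + ε⁻¹) ^ k * (s ^ k * Real.exp (-b * s))) atTop
      (𝓝 0) := by
    have := (tendsto_rpow_mul_exp_neg_mul_atTop_nhds_zero k b hb).const_mul
      (Real.exp K * (2 + ε⁻¹) ^ k)
    simpa using this
  refine tendsto_of_tendsto_of_tendsto_of_le_of_le' tendsto_const_nhds (h1.comp hytop) ?_ ?_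
  · exact Eventually.of_forall fun t => by positivity
  · filter_upwards [hy, hytop.eventually_ge_atTop 1] with t ht ht1
    have h2 : 1 + |t| + |y t| ≤ (2 + ε⁻¹) * y t := by
      rw [abs_of_nonneg (by linarith : 0 ≤ y t)]
      have : |t| ≤ ε⁻¹ * y t := by
        rw [inv_mul_eq_div, le_div_iff₀ hε]; linarith
      linarith
    calc Real.exp (K - b * y t) * (1 + |t| + |y t|) ^ k
        ≤ Real.exp (K - b * y t) * ((2 + ε⁻¹) * y t) ^ k := by gcongr
      _ = Real.exp K * (2 + ε⁻¹) ^ k * (y t ^ k * Real.exp (-b * y t)) := by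
        rw [sub_eq_add_neg, Real.exp_add, mul_pow]
        ring_nf

theorem tendsto_exp_mul_pow_abs {Y : ℝ → ℝ} {K c ε : ℝ} (hc : c ≠ 0) (hε : 0 < ε) (k : ℕ)
    (hl : Tendsto (fun t : ℝ => |t|) l atTop) (hy : ∀ᶠ t in l, ε * |t| ≤ c * Y t) :
    Tendsto (fun t : ℝ => Real.exp (K - 2 * (c * Y t)) * (1 + |t| + |Y t|) ^ k) l (𝓝 0) := by
  have hc' : 0 < |c| := abs_pos.mpr hc
  have hcy : ∀ᶠ t in l, c * Y t = |c| * |Y t| := by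
    filter_upwards [hy] with t ht
    rw [← abs_mul, abs_of_nonneg]
    exact le_trans (by positivity) ht
  have h1 := tendsto_exp_mul_pow (l := l) (y := fun t => |Y t|) (K := K) (b := 2 * |c|)
    (ε := ε / |c|) (by positivity) (by positivity) k hl (by
      filter_upwards [hy, hcy] with t ht ht'
      rw [ht'] at ht
      rw [div_mul_eq_mul_div, div_le_iff₀ hc']
      linarith)
  refine h1.congr' ?_
  filter_upwards [hcy] with t ht
  rw [ht, abs_abs, mul_assoc]

/-- `exp (2 θ)` and its derivatives decay where `Re θ₁ → -∞` at least linearly in `|t|`. -/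
theorem coeff_phaseSeries_tendsto_zero (hl : Tendsto (fun t : ℝ => |t|) l atTop) {ε : ℝ}
    (hz : z.im ≠ 0) (hε : 0 < ε)
    (hy : ∀ᶠ t in l, ε * |t| ≤ z.im * (x t - Hirota.velocity γ δ z * t)) (k : ℕ) :
    Tendsto (fun t => PowerSeries.coeff k (phaseSeries γ δ z a (x t) t)) l (𝓝 0) := by
  have h1 := isBigO_of_derivative_eq (l := l) (f := fun t => phaseSeries γ δ z a (x t) t)
    (h := fun t => (phasePoly γ δ z a (x t) t : PowerSeries ℂ))
    (ρ := fun t => Complex.exp ((phasePoly γ δ z a (x t) t).coeff 0))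
    (T := fun t : ℝ => 1 + |t| + |x t - Hirota.velocity γ δ z * t|)
    (fun t => by
      have h4 := abs_nonneg t
      have h5 := abs_nonneg (x t - Hirota.velocity γ δ z * t)
      linarith)
    (fun t => by rw [phaseSeries_eq, coeff_zero_taylorSeries, sub_self, coeff_zero_eq_eval_zero])
    (fun t => by rw [phaseSeries_eq, derivative_taylorSeries_exp])
    (fun k => by simpa using phasePoly_coeff_isBigO a (k + 1)) k
  refine h1.trans_tendsto ?_
  refine (tendsto_exp_mul_pow_abs (K := ((phasePolyConst a).coeff 0).re) hz hε k hl hy).congr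
    fun t => ?_
  rw [Complex.norm_exp, re_coeff_zero_phasePoly]
  ring_nf

theorem coeff_phaseSeriesInv_tendsto_zero (hl : Tendsto (fun t : ℝ => |t|) l atTop) {ε : ℝ}
    (hz : z.im ≠ 0) (hε : 0 < ε)
    (hy : ∀ᶠ t in l, ε * |t| ≤ -(z.im * (x t - Hirota.velocity γ δ z * t))) (k : ℕ) :
    Tendsto (fun t => PowerSeries.coeff k (phaseSeriesInv γ δ z a (x t) t)) l (𝓝 0) := by
  have h1 := isBigO_of_derivative_eq (l := l) (f := fun t => phaseSeriesInv γ δ z a (x t) t)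
    (h := fun t => ((-phasePoly γ δ z a (x t) t : ℂ[X]) : PowerSeries ℂ))
    (ρ := fun t => Complex.exp (-(phasePoly γ δ z a (x t) t).coeff 0))
    (T := fun t : ℝ => 1 + |t| + |x t - Hirota.velocity γ δ z * t|)
    (fun t => by
      have h4 := abs_nonneg t
      have h5 := abs_nonneg (x t - Hirota.velocity γ δ z * t)
      linarith)
    (fun t => by
      rw [phaseSeriesInv, coeff_zero_taylorSeries, sub_self, ← coeff_zero_eq_eval_zero, coeff_neg])
    (fun t => by rw [phaseSeriesInv, derivative_taylorSeries_exp])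
    (fun k => by simpa using phasePoly_coeff_isBigO a (k + 1)) k
  refine h1.trans_tendsto ?_
  refine (tendsto_exp_mul_pow_abs (K := -((phasePolyConst a).coeff 0).re) (neg_ne_zero.mpr hz) hε k
    hl (hy.mono fun t ht => by rwa [neg_mul])).congr fun t => ?_
  rw [Complex.norm_exp, Complex.neg_re, re_coeff_zero_phasePoly]
  ring_nf

end Far

/-! ### Asymptotics of the soliton -/

theorem tendsto_abs_of_eq {l : Filter ℝ} (hl : l = atTop ∨ l = atBot) :
    Tendsto (fun t : ℝ => |t|) l atTop := by
  rcases hl with rfl | rfl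
  · exact tendsto_abs_atTop_atTop
  · exact tendsto_abs_atBot_atTop

theorem tendsto_log_abs_div {l : Filter ℝ} (hl : Tendsto (fun t : ℝ => |t|) l atTop) :
    Tendsto (fun t : ℝ => Real.log |t| / t) l (𝓝 0) := by
  rw [tendsto_zero_iff_norm_tendsto_zero]
  have h1 := (Real.isLittleO_log_id_atTop.tendsto_div_nhds_zero.comp hl).norm
  rw [norm_zero] at h1
  refine h1.congr fun t => ?_
  simp

/-- `|ρ| |t| ^ n` is the exponential of the distance to the curve `y = n / (2 Im z) log |t|`. -/
theorem exp_mul_zpow_eq {K c y t : ℝ} (hc : c ≠ 0) (ht : 0 < |t|) (n : ℤ) :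
    Real.exp (K - 2 * c * y) * |t| ^ n =
      Real.exp (K - 2 * (c * (y - n / (2 * c) * Real.log |t|))) := by
  rw [← Real.exp_log (zpow_pos ht n), Real.log_zpow, ← Real.exp_add]
  congr 1
  field_simp
  ring

theorem tendsto_atTop_or_atBot_of_abs {ι : Type*} (u : Ultrafilter ι) {D : ι → ℝ}
    (hD : Tendsto (fun t => |D t|) u atTop) : Tendsto D u atTop ∨ Tendsto D u atBot := by
  rcases u.em (fun t => 0 ≤ D t) with h | h
  · left
    refine hD.congr' ?_
    filter_upwards [h] with t ht
    exact abs_of_nonneg ht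
  · right
    rw [← tendsto_neg_atTop_iff]
    refine hD.congr' ?_
    filter_upwards [h] with t ht
    exact abs_of_neg (not_le.mp ht)

section

variable {N : ℕ} {γ δ : ℝ} {z : ℂ} (a : Fin N → ℂ) {x : ℝ → ℝ}

theorem norm_exp_mul_zpow (hz : z.im ≠ 0) (n : ℤ) {t : ℝ} (ht : 0 < |t|) :
    ‖Complex.exp ((phasePoly γ δ z a (x t) t).coeff 0) *
        ((phasePolyTime γ δ z).coeff 1 * (t : ℂ)) ^ n‖ =
      ‖(phasePolyTime γ δ z).coeff 1‖ ^ n * Real.exp (((phasePolyConst a).coeff 0).re -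
        2 * (z.im * (x t - Hirota.velocity γ δ z * t - n / (2 * z.im) * Real.log |t|))) := by
  rw [← exp_mul_zpow_eq hz ht, norm_mul, Complex.norm_exp, re_coeff_zero_phasePoly, norm_zpow,
    norm_mul, mul_zpow, Complex.norm_real, Real.norm_eq_abs]
  ring

/-- The soliton vanishes along every curve that departs from all characteristic curves. -/
theorem tendsto_soliton_zero (hγδ : γ ≠ 0 ∨ δ ≠ 0) (hz : z.im ≠ 0) (hN : 1 ≤ N)
    {l : Filter ℝ} (hl : Tendsto (fun t : ℝ => |t|) l atTop)
    (hx : ∀ κ ∈ Finset.Icc 1 N,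
        Tendsto (fun t => |x t - Hirota.charCurve N γ δ z κ 0 t|) l atTop) :
    Tendsto (fun t : ℝ => Hirota.soliton γ δ z a (x t) t) l (𝓝 0) := by
  rw [tendsto_iff_ultrafilter]
  intro u hu
  have hlu := hl.mono_left hu
  choose A B hAB hq using fun t => exists_darbouxPair_soliton hN γ δ z hz a (x t) t
  simp only [hq]
  rw [← mul_zero (2 : ℂ)]
  refine Tendsto.const_mul _ ?_
  have hinv := fun t => phaseSeries_mul_inv γ δ z a (x t) t
  by_cases hnear : Tendsto (fun t => (x t - Hirota.velocity γ δ z * t) / t) u (𝓝 0)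
  · obtain ⟨hf, hfi⟩ := expLike_phaseSeries a hγδ hz hlu hnear
    set c := (phasePolyTime γ δ z).coeff 1 with hc
    have hc0 : c ≠ 0 := phasePolyTime_coeff_one_ne_zero γ δ z hγδ hz
    set ρ : ℝ → ℂ := fun t => Complex.exp ((phasePoly γ δ z a (x t) t).coeff 0) with hρ
    have hτ : Tendsto (fun t : ℝ => ‖c * (t : ℂ)‖) u atTop := by
      simpa using hlu.const_mul_atTop (norm_pos_iff.mpr hc0)
    -- For each `m`, the quantity `ρ τ ^ (N - 1 - 2 m)` tends to zero or to infinity, according to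
    -- the side of the curve `κ = m + 1`.
    have hdich : ∀ m < N,
        Tendsto (fun t : ℝ => ρ t * (c * (t : ℂ)) ^ ((N : ℤ) - 1 - 2 * m)) u (𝓝 0) ∨
        Tendsto (fun t : ℝ => (ρ t * (c * (t : ℂ)) ^ ((N : ℤ) - 1 - 2 * m))⁻¹) u (𝓝 0) := by
      intro m hm
      have h1 := (hx (m + 1) (by simp; omega)).mono_left hu
      set n : ℤ := (N : ℤ) - 1 - 2 * m with hn
      have h2 : Tendsto (fun t => |z.im * (x t - Hirota.velocity γ δ z * t -
          n / (2 * z.im) * Real.log |t|)|) u atTop := by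
        simp only [abs_mul]
        refine Tendsto.const_mul_atTop (abs_pos.mpr hz) (h1.congr fun t => ?_)
        congr 1
        rw [Hirota.charCurve, Hirota.logCoeff, hn]
        push_cast
        ring
      have hnorm : ∀ᶠ t in u, ‖ρ t * (c * (t : ℂ)) ^ n‖ =
          ‖c‖ ^ n * Real.exp (((phasePolyConst a).coeff 0).re -
        2 * (z.im * (x t - Hirota.velocity γ δ z * t - n / (2 * z.im) * Real.log |t|))) := by
        filter_upwards [hlu.eventually_gt_atTop 0] with t ht
        exact norm_exp_mul_zpow a hz n ht
      have hcn : 0 < ‖c‖ ^ n := zpow_pos (norm_pos_iff.mpr hc0) _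
      rcases tendsto_atTop_or_atBot_of_abs u h2 with h3 | h3
      · left
        rw [tendsto_zero_iff_norm_tendsto_zero]
        have h4 : Tendsto (fun t => ((phasePolyConst a).coeff 0).re -
          2 * (z.im * (x t - Hirota.velocity γ δ z * t - n / (2 * z.im) * Real.log |t|))) u
            atBot :=
          tendsto_atBot_add_const_left _ _ (tendsto_neg_atTop_atBot.comp
            (h3.const_mul_atTop two_pos))
        have h5 := (Real.tendsto_exp_atBot.comp h4).const_mul (‖c‖ ^ n)
        rw [mul_zero] at h5
        exact h5.congr' (hnorm.mono fun t ht => ht.symm)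
      · right
        rw [tendsto_zero_iff_norm_tendsto_zero]
        have h4 : Tendsto (fun t => ((phasePolyConst a).coeff 0).re -
          2 * (z.im * (x t - Hirota.velocity γ δ z * t - n / (2 * z.im) * Real.log |t|))) u
            atTop :=
          tendsto_atTop_add_const_left _ _ (tendsto_neg_atBot_atTop.comp
            (h3.const_mul_atBot two_pos))
        have h5 := ((Real.tendsto_exp_atTop.comp h4).const_mul_atTop hcn).inv_tendsto_atTop
        refine h5.congr' (hnorm.mono fun t ht => ?_)
        simp only [norm_inv, ht, Pi.inv_apply, Function.comp_apply]
    -- The least `m` with limit zero, or `N` if there is none, puts the curve into a gap.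
    classical
    have hex : ∃ m, m < N →
        Tendsto (fun t : ℝ => ρ t * (c * (t : ℂ)) ^ ((N : ℤ) - 1 - 2 * m)) u (𝓝 0) :=
      ⟨N, fun h => absurd h (lt_irrefl N)⟩
    have hmN : Nat.find hex ≤ N := Nat.find_min' hex fun h => absurd h (lt_irrefl N)
    refine tendsto_zero_of_gap u hz hAB hinv (Eventually.of_forall fun t => Complex.exp_ne_zero _)
      hτ hf hfi hmN (fun h1 => ?_) (Nat.find_spec hex) _
    have h2 := Nat.find_min hex (m := Nat.find hex - 1) (by omega)
    rw [Classical.not_imp] at h2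
    refine ((hdich _ h2.1).resolve_left h2.2).congr fun t => ?_
    rw [mul_inv, ← zpow_neg]
    congr 2
    rw [Nat.cast_sub h1]
    push_cast
    ring
  · -- Otherwise `|y| ≥ ε |t|`, and `f` or `1 / f` decays exponentially.
    have hfar : ∃ ε > 0, ∀ᶠ t in u,
        ε * |t| ≤ |z.im * (x t - Hirota.velocity γ δ z * t)| := by
      rw [Metric.tendsto_nhds] at hnear
      push Not at hnear
      obtain ⟨ε, hε, h1⟩ := hnear
      refine ⟨|z.im| * ε, mul_pos (abs_pos.mpr hz) hε, ?_⟩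
      filter_upwards [h1, hlu.eventually_gt_atTop 0] with t ht ht0
      rw [dist_zero_right, Real.norm_eq_abs, abs_div, le_div_iff₀ ht0] at ht
      rw [abs_mul, mul_assoc]
      exact mul_le_mul_of_nonneg_left ht (abs_nonneg _)
    obtain ⟨ε, hε, hfar⟩ := hfar
    rcases u.em (fun t => 0 ≤ z.im * (x t - Hirota.velocity γ δ z * t)) with h | h
    · refine tendsto_zero_of_coeff_tendsto_zero u hz hAB (fun k _ => ?_) _
      refine coeff_phaseSeries_tendsto_zero a hlu hz hε ?_ k
      filter_upwards [hfar, h] with t ht ht'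
      rwa [abs_of_nonneg ht'] at ht
    · refine tendsto_zero_of_coeff_inv_tendsto_zero u hz hAB hinv (fun k _ => ?_) _
      refine coeff_phaseSeriesInv_tendsto_zero a hlu hz hε ?_ k
      filter_upwards [hfar, h] with t ht ht'
      rwa [abs_of_neg (not_le.mp ht')] at ht

theorem tendsto_soliton_charCurve (hγδ : γ ≠ 0 ∨ δ ≠ 0) (hz : z.im ≠ 0) (hN : 1 ≤ N)
    {l : Filter ℝ} (hl : l = atTop ∨ l = atBot) {κ : ℕ} (hκ : κ ∈ Finset.Icc 1 N) (s : ℝ) :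
    ∃ c : ℂ, c ≠ 0 ∧
      Tendsto (fun t : ℝ =>
        Complex.exp (2 * Complex.I *
          ((Hirota.phase γ δ z a (Hirota.charCurve N γ δ z κ s t) t z).im : ℂ)) *
        Hirota.soliton γ δ z a (Hirota.charCurve N γ δ z κ s t) t) l (𝓝 c) := by
  have hla := tendsto_abs_of_eq hl
  have hlne : l.NeBot := by rcases hl with rfl | rfl <;> infer_instance
  set x : ℝ → ℝ := Hirota.charCurve N γ δ z κ s with hxdef
  have hxy : ∀ t, x t - Hirota.velocity γ δ z * t = s + Hirota.logCoeff N z κ * Real.log |t| := by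
    intro t
    rw [hxdef, Hirota.charCurve]
    ring
  have hnear : Tendsto (fun t => (x t - Hirota.velocity γ δ z * t) / t) l (𝓝 0) := by
    have hinv : Tendsto (fun t : ℝ => t⁻¹) l (𝓝 0) := by
      rcases hl with rfl | rfl
      · exact tendsto_inv_atTop_zero
      · exact tendsto_inv_atBot_zero
    have h1 := (hinv.const_mul s).add ((tendsto_log_abs_div hla).const_mul (Hirota.logCoeff N z κ))
    rw [mul_zero, mul_zero, add_zero] at h1
    refine h1.congr fun t => ?_
    rw [hxy]
    ring
  choose A B hAB hq using fun t => exists_darbouxPair_soliton hN γ δ z hz a (x t) t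
  have hinv := fun t => phaseSeries_mul_inv γ δ z a (x t) t
  obtain ⟨hf, hfi⟩ := expLike_phaseSeries a hγδ hz hla hnear
  set c := (phasePolyTime γ δ z).coeff 1 with hc
  have hc0 : c ≠ 0 := phasePolyTime_coeff_one_ne_zero γ δ z hγδ hz
  have hτ : Tendsto (fun t : ℝ => ‖c * (t : ℂ)‖) l atTop := by
    simpa using hla.const_mul_atTop (norm_pos_iff.mpr hc0)
  have hphase : ∀ t, (phasePoly γ δ z a (x t) t).coeff 0 = 2 * Hirota.phase γ δ z a (x t) t z := by
    intro t
    rw [two_mul_phase, sub_self, coeff_zero_eq_eval_zero]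
  set χ : ℝ → ℂ := fun t =>
    Complex.exp (2 * Complex.I * ((Hirota.phase γ δ z a (x t) t z).im : ℂ)) with hχdef
  have hχ : ∀ t, ‖χ t‖ = 1 := by
    intro t
    rw [hχdef]
    simp only []
    rw [Complex.norm_exp]
    simp
  have hχ1 : ∀ t, χ t * (starRingEnd ℂ) (χ t) = 1 := by
    intro t; rw [Complex.mul_conj']; simp [hχ t]
  have hχ0 : ∀ t, χ t ≠ 0 := fun t => Complex.exp_ne_zero _
  set ρ : ℝ → ℂ := fun t => (Real.exp ((phasePoly γ δ z a (x t) t).coeff 0).re : ℂ) with hρdef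
  have hρ : ∀ t, Complex.exp ((phasePoly γ δ z a (x t) t).coeff 0) = χ t * ρ t := by
    intro t
    rw [hρdef, hχdef]
    simp only []
    rw [Complex.ofReal_exp, ← Complex.exp_add, hphase]
    congr 1
    apply Complex.ext <;> simp
  -- The gauge `b ↦ χ b`, `f ↦ χ⁻¹ f` replaces `ρ` by its modulus.
  have hf' : ExpLike l N (fun t => PowerSeries.C ((starRingEnd ℂ) (χ t)) *
      phaseSeries γ δ z a (x t) t) ρ (fun t => c * t) := by
    intro k hk
    refine (hf k hk).congr fun t => ?_
    simp only [PowerSeries.coeff_C_mul, hρ, ← inv_eq_of_mul_eq_one_right (hχ1 t)]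
    rw [mul_assoc, ← div_div, inv_mul_eq_div]
  have hfi' : ExpLike l N (fun t => PowerSeries.C (χ t) * phaseSeriesInv γ δ z a (x t) t)
      (fun t => (ρ t)⁻¹) (fun t => -(c * t)) := by
    intro k hk
    refine (hfi k hk).congr fun t => ?_
    simp only [PowerSeries.coeff_C_mul, hρ]
    rw [mul_inv, mul_assoc, ← div_div, div_inv_eq_mul, mul_comm (χ t)]
  simp only [Finset.mem_Icc] at hκ
  obtain ⟨m, rfl⟩ : ∃ m, κ = m + 1 := ⟨κ - 1, by omega⟩
  set n : ℤ := (N : ℤ) - 1 - 2 * m with hn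
  -- Along the curve `|ρ| |t| ^ n` is constant.
  have hω : ∃ ω : ℂ, ω ≠ 0 ∧ Tendsto (fun t : ℝ => ρ t * (c * (t : ℂ)) ^ n) l (𝓝 ω) := by
    set K : ℝ := Real.exp (((phasePolyConst a).coeff 0).re - 2 * (z.im * s)) with hK
    have hρt : ∀ t : ℝ, 0 < |t| →
        ρ t * (c * (t : ℂ)) ^ n = K * c ^ n * ((t / |t| : ℝ) : ℂ) ^ n := by
      intro t ht
      have h1 : Real.exp ((phasePoly γ δ z a (x t) t).coeff 0).re * |t| ^ n = K := by
        rw [re_coeff_zero_phasePoly, exp_mul_zpow_eq hz ht, hxy, hK, Hirota.logCoeff, hn]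
        congr 1
        push_cast
        field_simp
        ring
      rw [← h1, hρdef]
      have h2 : ((|t| : ℝ) : ℂ) ≠ 0 := by exact_mod_cast ht.ne'
      push_cast
      rw [mul_zpow, div_zpow]
      field_simp
    have hK0 : (K : ℂ) ≠ 0 := by exact_mod_cast (Real.exp_pos _).ne'
    rcases hl with rfl | rfl
    · refine ⟨K * c ^ n, mul_ne_zero hK0 (zpow_ne_zero _ hc0), ?_⟩
      refine tendsto_const_nhds.congr' ?_
      filter_upwards [eventually_gt_atTop 0] with t ht
      rw [hρt t (abs_pos.mpr ht.ne'), abs_of_pos ht, div_self ht.ne']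
      simp
    · refine ⟨K * c ^ n * (-1) ^ n, mul_ne_zero (mul_ne_zero hK0 (zpow_ne_zero _ hc0))
        (zpow_ne_zero _ (by simp)), ?_⟩
      refine tendsto_const_nhds.congr' ?_
      filter_upwards [eventually_lt_atBot 0] with t ht
      rw [hρt t (abs_pos.mpr ht.ne), abs_of_neg ht, div_neg, div_self ht.ne]
      simp
  obtain ⟨ω, hω0, hω⟩ := hω
  obtain ⟨β, hβ0, hβ⟩ := tendsto_of_balance hz (fun t => (hAB t).gauge (hχ t)) (fun t => by
      rw [mul_mul_mul_comm, hinv t, mul_one, ← map_mul, mul_comm, hχ1, map_one])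
    (Eventually.of_forall fun t => by
      exact Complex.ofReal_ne_zero.mpr (Real.exp_pos _).ne') hτ hf' hfi' (by omega : m < N) hω0 hω
  refine ⟨2 * β, mul_ne_zero two_ne_zero hβ0, (hβ.const_mul 2).congr fun t => ?_⟩
  rw [hq, coeff_C_mul]
  ring

theorem tendsto_abs_sub_charCurve {l : Filter ℝ} (hl : Tendsto (fun t : ℝ => |t|) l atTop)
    {s v β : ℝ} {κ : ℕ} (h : v ≠ Hirota.velocity γ δ z ∨ β ≠ Hirota.logCoeff N z κ) :
    Tendsto (fun t : ℝ => |s + v * t + β * Real.log |t| - Hirota.charCurve N γ δ z κ 0 t|) l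
      atTop := by
  set dv := v - Hirota.velocity γ δ z with hdv
  set dβ := β - Hirota.logCoeff N z κ with hdβ
  have heq : ∀ t : ℝ, s + v * t + β * Real.log |t| - Hirota.charCurve N γ δ z κ 0 t =
      s + dv * t + dβ * Real.log |t| := by
    intro t
    rw [Hirota.charCurve, hdv, hdβ]
    ring
  simp only [heq]
  by_cases hv : dv = 0
  · have hβ : dβ ≠ 0 := by
      rcases h with h | h
      · exact absurd hv (sub_ne_zero.mpr h)
      · exact sub_ne_zero.mpr h
    simp only [hv, zero_mul, add_zero]
    have hlog := (Real.tendsto_log_atTop.comp hl).const_mul_atTop (abs_pos.mpr hβ)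
    refine tendsto_atTop_mono (fun t => ?_) (tendsto_atTop_add_const_right _ (-|s|) hlog)
    have h1 := abs_sub_abs_le_abs_sub (dβ * Real.log |t|) (-s)
    rw [abs_mul, abs_neg, sub_neg_eq_add, add_comm (dβ * Real.log |t|)] at h1
    have h2 := mul_le_mul_of_nonneg_left (le_abs_self (Real.log |t|)) (abs_nonneg dβ)
    simp only [Function.comp]
    linarith
  · have hinv : Tendsto (fun t : ℝ => t⁻¹) l (𝓝 0) := by
      rw [tendsto_zero_iff_norm_tendsto_zero]
      refine hl.inv_tendsto_atTop.congr fun t => ?_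
      simp
    have h1 := (((hinv.const_mul s).add_const dv).add
      ((tendsto_log_abs_div hl).const_mul dβ)).abs
    simp only [mul_zero, zero_add, add_zero] at h1
    refine (h1.pos_mul_atTop (abs_pos.mpr hv) hl).congr' ?_
    filter_upwards [hl.eventually_gt_atTop 0] with t ht
    have ht0 : t ≠ 0 := abs_pos.mp ht
    rw [← abs_mul]
    congr 1
    field_simp

end

end Hirota

theorem lemma4p5 (γ δ : ℝ) (hγδ : γ ≠ 0 ∨ δ ≠ 0) (lam1 : ℂ) (hlam1 : lam1.im ≠ 0)
    (N : ℕ) (hN : 1 ≤ N) (a : Fin N → ℂ)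
    (l : Filter ℝ) (hl : l = atTop ∨ l = atBot) :
    -- a non-zero limit, after removal of the unimodular carrier wave `exp (-2 i Im θ₁)`,
    -- along each characteristic curve
    (∀ κ ∈ Finset.Icc 1 N, ∀ s : ℝ, ∃ c : ℂ, c ≠ 0 ∧
      Tendsto (fun t : ℝ =>
        Complex.exp (2 * Complex.I *
          ((Hirota.phase γ δ lam1 a (Hirota.charCurve N γ δ lam1 κ s t) t lam1).im : ℂ)) *
        Hirota.soliton γ δ lam1 a (Hirota.charCurve N γ δ lam1 κ s t) t) l (𝓝 c)) ∧
    -- limit zero along all the other curves `x = s + v t + β log |t|`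
    (∀ s v β : ℝ,
      (v ≠ Hirota.velocity γ δ lam1 ∨ ∀ κ ∈ Finset.Icc 1 N, β ≠ Hirota.logCoeff N lam1 κ) →
      Tendsto (fun t : ℝ => Hirota.soliton γ δ lam1 a (s + v * t + β * Real.log |t|) t) l (𝓝 0)) ∧
    -- more generally, limit zero along every curve that departs from all characteristic curves
    (∀ X : ℝ → ℝ,
      (∀ κ ∈ Finset.Icc 1 N,
        Tendsto (fun t : ℝ => |X t - Hirota.charCurve N γ δ lam1 κ 0 t|) l atTop) →
      Tendsto (fun t : ℝ => Hirota.soliton γ δ lam1 a (X t) t) l (𝓝 0)) := by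
  have hla := Hirota.tendsto_abs_of_eq hl
  refine ⟨fun κ hκ s => Hirota.tendsto_soliton_charCurve a hγδ hlam1 hN hl hκ s, fun s v β h => ?_,
    fun X hX => Hirota.tendsto_soliton_zero a hγδ hlam1 hN hla hX⟩
  exact Hirota.tendsto_soliton_zero a hγδ hlam1 hN hla fun κ hκ =>
    Hirota.tendsto_abs_sub_charCurve hla (h.imp_right fun h' => h' κ hκ)
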